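/- **Setting (Feedback MAB).** There are $n$ arms. The hidden state of arm $i$ is good or bad and evolves, independently of the other arms and of the plays, as a two-state Markov chain with $\Pr[\text{bad}\to\text{good}]=\alpha_i>0$, $\Pr[\text{good}\to\text{bad}]=\beta_i>0$ and $\alpha_i+\beta_i\le 1-\delta$ for some $\delta>0$. In each step a policy (possibly randomized and history-dependent) plays at most one arm; playing arm $i$ reveals its current state and yields reward $r_i\ge 0$ if that state is good and $0$ otherwise; arms that are not played are not observed. Thus the player's information on arm $i$ is a pair $(s,t)$: the arm was last observed $t\ge1$ steps ago, in state $s\in\{g,b\}$. The initial information $(s_i,t_i)$ on every arm is given and arbitrary. **Single-arm problem.** For a penalty $\lambda$ per play, let $H_i(\lambda)$ be the optimal long-run average of reward minus penalty when only arm $i$ is present and it may be played or not in each step (this does not depend on the initial information). Let $\omega$ denote the probability that the arm is good at present. Playing is an optimal decision at belief $\omega_0$ if there is a continuous relative value function $V:[0,1]\to\mathbb R$ that solves the average-reward optimality equation $$H_i(\lambda)+V(\omega)=\max\bigl\{\omega\,(r_i+V(1-\beta_i))+(1-\omega)V(\alpha_i)-\lambda,\;\; V(\omega(1-\beta_i)+(1-\omega)\alpha_i)\bigr\}\qquad(0\le\omega\le1)$$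 and for which the first term (play) is at least the second (do not play) at $\omega=\omega_0$. The Whittle index $\Pi_i(s,t)$ is the supremum of the penalties $\lambda$ for which playing is an optimal decision at the belief that corresponds to $(s,t)$. **Policy.** Threshold-Whittle$(\lambda)$ acts as follows in each step: if some arm $i$ is in state $(g,1)$ and $r_i(1-\beta_i)\ge\lambda$, it plays such an arm; otherwise it plays an arm whose current state has the highest Whittle index. Ties are broken arbitrarily. **Theorem.** There is exactly one real number $\lambda^*$ with $\lambda^*=\sum_{i=1}^n H_i(\lambda^*)$, and Threshold-Whittle$(\lambda^*)$ is a $2$-approximation for Feedback MAB: if $R_T(\pi)$ denotes the expected total reward of a policy $\pi$ in the first $T$ steps, then for every Threshold-Whittle$(\lambda^*)$ policy $\pi$ and every policy $\sigma$, $$\limsup_{T\to\infty}\frac{R_T(\sigma)}{T}\;\le\;2\,\liminf_{T\to\infty}\frac{R_T(\pi)}{T}.$$ -/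

import Mathlib

open Filter

noncomputable section

namespace FeedbackMAB

/-- The data of one arm: a two-state Markov chain with `Pr[bad → good] = α`,
`Pr[good → bad] = β`, and the reward `r` of a play in the good state.  The chain is ergodic
(`α, β > 0`) and bursty (`α + β ≤ 1 - δ` for some `δ > 0`). -/
structure Arm where
  α : ℝ
  β : ℝ
  r : ℝ
  α_pos : 0 < α
  β_pos : 0 < β
  bursty : α + β < 1
  r_nonneg : 0 ≤ r

/-- The information `(s, t)` on an arm: it was last observed `t ≥ 1` steps ago, in state `s`
(`true` is the good state `g`, `false` is the bad state `b`). -/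
abbrev InfoState : Type := Bool × ℕ+

/-- One-step transition probabilities of the hidden state of an arm. -/
def Arm.trans (a : Arm) : Bool → Bool → ℝ
  | true, true => 1 - a.β
  | true, false => a.β
  | false, true => a.α
  | false, false => 1 - a.α

/-- If an arm is good with probability `ω` now, it is good with this probability one step later. -/
def Arm.evolve (a : Arm) (ω : ℝ) : ℝ := ω * (1 - a.β) + (1 - ω) * a.α

/-- Probability that the arm is good `t` steps after it was in state `s`. -/
def Arm.goodProb (a : Arm) (s : Bool) : ℕ → ℝ
  | 0 => if s then 1 else 0
  | t + 1 => a.evolve (a.goodProb s t)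

/-- Probability that the arm is good now, given the information `(s, t)`
(this is `u_t` for `s = g` and `v_t` for `s = b`). -/
def Arm.belief (a : Arm) (x : InfoState) : ℝ := a.goodProb x.1 x.2

section Bandit

variable {ι : Type} [Fintype ι] [DecidableEq ι]

/-- What the player has seen, most recent step first: `none` for a step without a play,
`some (i, s)` for a step in which arm `i` was played and found in state `s`. -/
abbrev History (ι : Type) : Type := List (Option (ι × Bool))

/-- A (randomized, history-dependent) policy: the law of the next action, given the history.
The action `some i` plays arm `i`, and `none` plays no arm. -/
abbrev Policy (ι : Type) : Type := History ι → PMF (Option ι)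

/-- What is seen when the hidden states are `s` and the action `c` is taken. -/
def observe (s : ι → Bool) (c : Option ι) : Option (ι × Bool) := c.map fun i => (i, s i)

/-- Immediate reward, minus a penalty `lam` per play. -/
def payoff (arms : ι → Arm) (lam : ℝ) (s : ι → Bool) : Option ι → ℝ
  | none => 0
  | some i => (if s i then (arms i).r else 0) - lam

/-- Expected total reward minus penalty in the next `T` steps under the policy `π`, given the
history and the current hidden states.  The arms evolve independently of each other and of the
plays. -/
def totalFrom (arms : ι → Arm) (lam : ℝ) (π : Policy ι) : ℕ → History ι → (ι → Bool) → ℝ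
  | 0, _, _ => 0
  | T + 1, h, s => ∑ c : Option ι, (π h c).toReal *
      (payoff arms lam s c +
        ∑ s' : ι → Bool, (∏ i, (arms i).trans (s i) (s' i)) *
          totalFrom arms lam π T (observe s c :: h) s')

/-- Expected total reward minus penalty in the first `T` steps under the policy `π`, when the
initial information on arm `i` is `x i`. -/
def total (arms : ι → Arm) (lam : ℝ) (x : ι → InfoState) (π : Policy ι) (T : ℕ) : ℝ :=
  ∑ s : ι → Bool,
    (∏ i, if s i then (arms i).belief (x i) else 1 - (arms i).belief (x i)) *
      totalFrom arms lam π T [] s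

/-- Expected reward per step in the first `T` steps (no penalty). -/
def averageReward (arms : ι → Arm) (x : ι → InfoState) (π : Policy ι) (T : ℕ) : ℝ :=
  total arms 0 x π T / T

/-- The information on all arms after the history, starting from `x`. -/
def infoAfter (x : ι → InfoState) : History ι → ι → InfoState
  | [] => x
  | none :: h => fun i => ((infoAfter x h i).1, (infoAfter x h i).2 + 1)
  | some (j, s) :: h => fun i =>
      if i = j then (s, 1) else ((infoAfter x h i).1, (infoAfter x h i).2 + 1)

end Bandit

/-- `H(lam)`: the optimal long-run average of reward minus penalty in the single-arm problem, in
which the arm may or may not be played in each step and each play costs `lam`.  (The chain being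
ergodic, the optimum does not depend on the initial information.) -/
def Arm.H (a : Arm) (lam : ℝ) : ℝ :=
  sSup {c : ℝ | ∃ (x : InfoState) (π : Policy Unit),
    c = liminf (fun T : ℕ => total (fun _ : Unit => a) lam (fun _ => x) π T / (T : ℝ)) atTop}

/-- One-step lookahead value of playing the arm when it is good with probability `ω`, if `V` is
the relative value of the next belief: the play reveals the state. -/
def Arm.playValue (a : Arm) (lam : ℝ) (V : ℝ → ℝ) (ω : ℝ) : ℝ :=
  ω * (a.r + V (1 - a.β)) + (1 - ω) * V a.α - lam

/-- One-step lookahead value of not playing the arm. -/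
def Arm.restValue (a : Arm) (V : ℝ → ℝ) (ω : ℝ) : ℝ := V (a.evolve ω)

/-- `V` is a relative value function of the single-arm problem with penalty `lam`: a continuous
function of the belief that solves the average-reward optimality (Bellman) equation. -/
def Arm.IsRelativeValue (a : Arm) (lam : ℝ) (V : ℝ → ℝ) : Prop :=
  ContinuousOn V (Set.Icc 0 1) ∧
    ∀ ω ∈ Set.Icc (0 : ℝ) 1, a.H lam + V ω = max (a.playValue lam V ω) (a.restValue V ω)

/-- Playing is an optimal decision in the information state `x` of the single-arm problem with
penalty `lam`. -/
def Arm.PlayOptimal (a : Arm) (lam : ℝ) (x : InfoState) : Prop :=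
  ∃ V : ℝ → ℝ, a.IsRelativeValue lam V ∧
    a.restValue V (a.belief x) ≤ a.playValue lam V (a.belief x)

/-- The Whittle index of the information state `x`: the largest penalty per play at which the
optimal decision in `x` switches from not playing to playing as the penalty decreases. -/
def Arm.whittleIndex (a : Arm) (x : InfoState) : ℝ := sSup {lam : ℝ | a.PlayOptimal lam x}

section ThresholdWhittle

variable {ι : Type}

/-- Arm `i` is in state `(g, 1)` and its myopic reward is at least the threshold. -/
def TopPriority (arms : ι → Arm) (lam : ℝ) (x : ι → InfoState) (i : ι) : Prop :=
  x i = (true, 1) ∧ lam ≤ (arms i).r * (1 - (arms i).β)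

/-- Arm `i` is a choice of the Threshold-Whittle rule in the joint information state `x`: an arm of
top priority if there is one, and otherwise an arm of highest Whittle index. -/
def ThresholdWhittleChoice (arms : ι → Arm) (lam : ℝ) (x : ι → InfoState) (i : ι) : Prop :=
  TopPriority arms lam x i ∨
    ((∀ j, ¬ TopPriority arms lam x j) ∧
      ∀ j, (arms j).whittleIndex (x j) ≤ (arms i).whittleIndex (x i))

/-- `π` is a Threshold-Whittle policy (ties may be broken in any way). -/
def IsThresholdWhittle [DecidableEq ι] (arms : ι → Arm) (lam : ℝ) (x : ι → InfoState)
    (π : Policy ι) : Prop :=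
  ∀ h : History ι, ∀ c ∈ (π h).support,
    ∃ i, c = some i ∧ ThresholdWhittleChoice arms lam (infoAfter x h) i

end ThresholdWhittle

end FeedbackMAB

end

/-! Given the history, the hidden states are independent and each is described by its information
state, so a total reward can be estimated through the one-step drift of a potential on histories
(`totalAfter_le`, `le_totalAfter`). Both bounds of the theorem are of this kind: every policy has
limsup at most `lam + ∑ H_i(lam)`, which is `2 * lam` at the fixed point, and Threshold-Whittle has
liminf at least `lam`.

Single arm, `lam ≥ 0`. `H` equals `optRate`, the best rate among never playing and the policies that
play after a good observation and wait `t` steps after a bad one. The upper bound comes from a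
solution of the Bellman inequality (`exists_bellman_le`), the lower bound from the potential
`waitValue`. The belief after a bad observation is concave in the waiting time, so waiting pays
exactly before `waitTime`.

Upper bound (`exists_total_le`). The sum of the single-arm Bellman potentials drifts by at most `∑
H_i` after a charge of `lam` per play, and there is at most one play per step.

Lower bound (`exists_le_total_of_isThresholdWhittle`). Each arm has a bounded potential
(`IsPotential`) whose drift, with no charge for playing, is as follows. A play yields at least `H_i`
always, and at least `lam` if the index is at least `lam` or the arm has top priority; a rest yields
at least `0` without top priority, and at least `H_i` if moreover the index is below `lam`. If the
chosen arm has top priority or index at least `lam`, it alone contributes `lam`. Otherwise all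
indices are below `lam` and the arms together contribute `∑ H_i = lam`.

Indexability is not needed. It suffices to compare the index with this one `lam`: an explicit
relative value function shows that it is at least `lam` (`playOptimal_of_forall`), and a condition
satisfied by every relative value function shows that it is smaller (`whittleIndex_bad_lt`). -/

namespace FeedbackMAB

/-! ### Beliefs of a single arm. -/

/-- Probability of the state `s` under the information `x`. -/
noncomputable def Arm.stateProb (a : Arm) (x : InfoState) (s : Bool) : ℝ :=
  if s then a.belief x else 1 - a.belief x

theorem Arm.goodProb_mem (a : Arm) (s : Bool) (t : ℕ) : a.goodProb s t ∈ Set.Icc (0 : ℝ) 1 := by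
  induction t with
  | zero => cases s <;> simp [Arm.goodProb]
  | succ t ih =>
    obtain ⟨h0, h1⟩ := ih
    have := a.α_pos
    have := a.β_pos
    have := a.bursty
    simp only [Arm.goodProb, Arm.evolve]
    constructor <;> nlinarith

theorem Arm.belief_mem (a : Arm) (x : InfoState) : a.belief x ∈ Set.Icc (0 : ℝ) 1 :=
  a.goodProb_mem _ _

theorem Arm.belief_succ (a : Arm) (s : Bool) (t : ℕ+) :
    a.belief (s, t + 1) = a.evolve (a.belief (s, t)) := by
  simp [Arm.belief, Arm.goodProb]

theorem Arm.belief_good_one (a : Arm) : a.belief (true, 1) = 1 - a.β := by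
  simp [Arm.belief, Arm.goodProb, Arm.evolve]

theorem Arm.belief_bad_one (a : Arm) : a.belief (false, 1) = a.α := by
  simp [Arm.belief, Arm.goodProb, Arm.evolve]

theorem Arm.sum_stateProb_mul_trans (a : Arm) (x : InfoState) (s' : Bool) :
    ∑ s, a.stateProb x s * a.trans s s' = a.stateProb (x.1, x.2 + 1) s' := by
  have h := a.belief_succ x.1 x.2
  cases s'
  · simp [Arm.stateProb, Arm.trans, h, Arm.evolve]
    ring
  · simp [Arm.stateProb, Arm.trans, h, Arm.evolve]

theorem Arm.trans_eq_stateProb (a : Arm) (s s' : Bool) :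
    a.trans s s' = a.stateProb (s, 1) s' := by
  cases s <;> cases s' <;>
    simp [Arm.stateProb, Arm.trans, a.belief_good_one, a.belief_bad_one]

theorem Arm.sum_stateProb (a : Arm) (x : InfoState) : ∑ s, a.stateProb x s = 1 := by
  simp [Arm.stateProb]

/-! ### Reduction to the belief process, and drift bounds for totals. -/

section Lookahead

variable {ι : Type} [DecidableEq ι]

/-- Expected payoff of an action plus expected value `F` of the next history, given the
history `h`. -/
noncomputable def lookahead (arms : ι → Arm) (lam : ℝ) (x : ι → InfoState) (F : History ι → ℝ)
    (h : History ι) : Option ι → ℝ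
  | none => F (none :: h)
  | some i => (arms i).belief (infoAfter x h i) * ((arms i).r + F (some (i, true) :: h)) +
      (1 - (arms i).belief (infoAfter x h i)) * F (some (i, false) :: h) - lam

theorem lookahead_mono (arms : ι → Arm) (lam : ℝ) (x : ι → InfoState) {F G : History ι → ℝ}
    (hFG : ∀ h, F h ≤ G h) (h : History ι) (c : Option ι) :
    lookahead arms lam x F h c ≤ lookahead arms lam x G h c := by
  cases c with
  | none => exact hFG _
  | some i =>
    obtain ⟨h0, h1⟩ := (arms i).belief_mem (infoAfter x h i)
    have := mul_le_mul_of_nonneg_left (hFG (some (i, true) :: h)) h0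
    have := mul_le_mul_of_nonneg_left (hFG (some (i, false) :: h)) (sub_nonneg.2 h1)
    simp only [lookahead]
    linarith

theorem lookahead_add_const (arms : ι → Arm) (lam : ℝ) (x : ι → InfoState) (F : History ι → ℝ)
    (k : ℝ) (h : History ι) (c : Option ι) :
    lookahead arms lam x (fun h => F h + k) h c = lookahead arms lam x F h c + k := by
  cases c with
  | none => rfl
  | some i => simp only [lookahead]; ring

end Lookahead

theorem Policy.sum_toReal {ι : Type} [Fintype ι] (π : Policy ι) (h : History ι) :
    ∑ c, (π h c).toReal = 1 := by
  rw [← ENNReal.toReal_sum fun c _ => (π h).apply_ne_top c, ← tsum_fintype (L := .unconditional _),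
    (π h).tsum_coe, ENNReal.toReal_one]

section Bandit

variable {ι : Type} [Fintype ι] [DecidableEq ι]

theorem sum_prod_eq_prod_sum (f : ι → Bool → ℝ) :
    ∑ s : ι → Bool, ∏ i, f i (s i) = ∏ i, ∑ b, f i b := by
  rw [Finset.prod_univ_sum, Fintype.piFinset_univ]

/-- Expectation of a function of the hidden states given independent information on the arms. -/
noncomputable def expect (arms : ι → Arm) (y : ι → InfoState) (F : (ι → Bool) → ℝ) : ℝ :=
  ∑ s : ι → Bool, (∏ i, (arms i).stateProb (y i) (s i)) * F s

theorem expect_trans (arms : ι → Arm) (y : ι → InfoState) (F : (ι → Bool) → ℝ) :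
    expect arms y (fun s => ∑ s' : ι → Bool, (∏ i, (arms i).trans (s i) (s' i)) * F s') =
      expect arms (fun i => ((y i).1, (y i).2 + 1)) F := by
  simp only [expect, Finset.mul_sum]
  rw [Finset.sum_comm]
  refine Finset.sum_congr rfl fun s' _ => ?_
  simp only [← mul_assoc, ← Finset.sum_mul, ← Finset.prod_mul_distrib]
  rw [sum_prod_eq_prod_sum (fun i b => (arms i).stateProb (y i) b * (arms i).trans b (s' i))]
  simp only [Arm.sum_stateProb_mul_trans]

/-- A product law stays a product law after one coordinate is observed: only that factor is replaced
by a point mass, and the chains then move independently. -/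
theorem expect_observe_trans (arms : ι → Arm) (y : ι → InfoState) (j : ι)
    (F : Bool → (ι → Bool) → ℝ) :
    expect arms y (fun s => ∑ s' : ι → Bool, (∏ i, (arms i).trans (s i) (s' i)) * F (s j) s') =
      ∑ b, (arms j).stateProb (y j) b *
        expect arms (fun i => if i = j then (b, 1) else ((y i).1, (y i).2 + 1)) (F b) := by
  have key : ∀ (b : Bool) (s' : ι → Bool),
      ∑ s : ι → Bool, (∏ i, (arms i).stateProb (y i) (s i)) *
        (∏ i, (arms i).trans (s i) (s' i)) * (if s j = b then 1 else 0) =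
      (arms j).stateProb (y j) b *
        ∏ i, (arms i).stateProb (if i = j then (b, 1) else ((y i).1, (y i).2 + 1)) (s' i) := by
    intro b s'
    -- The indicator of the observation is absorbed into the factor of arm `j`, so that the sum over
    -- joint states factors over the arms.
    have e1 : ∀ s : ι → Bool, (∏ i, (arms i).stateProb (y i) (s i)) *
        (∏ i, (arms i).trans (s i) (s' i)) * (if s j = b then 1 else 0) =
        ∏ i, ((arms i).stateProb (y i) (s i) * (arms i).trans (s i) (s' i) *
          (if i = j then (if s i = b then 1 else 0) else 1)) := by
      intro s
      rw [Finset.prod_mul_distrib, Finset.prod_mul_distrib, Finset.prod_ite_eq' ]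
      simp
    simp only [e1]
    rw [sum_prod_eq_prod_sum (fun i c => (arms i).stateProb (y i) c * (arms i).trans c (s' i) *
          (if i = j then (if c = b then 1 else 0) else 1))]
    have e2 : ∀ i, ∑ c, (arms i).stateProb (y i) c * (arms i).trans c (s' i) *
          (if i = j then (if c = b then 1 else 0) else 1) =
        (if i = j then (arms i).stateProb (y i) b else 1) *
          (arms i).stateProb (if i = j then (b, 1) else ((y i).1, (y i).2 + 1)) (s' i) := by
      intro i
      by_cases hij : i = j
      · simp [hij, Arm.trans_eq_stateProb]
      · simp only [hij, if_false, mul_one, one_mul]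
        exact Arm.sum_stateProb_mul_trans _ _ _
    simp only [e2]
    rw [Finset.prod_mul_distrib, Finset.prod_ite_eq']
    simp
  have e3 : ∀ (s s' : ι → Bool), F (s j) s' = ∑ b, (if s j = b then 1 else 0) * F b s' := by
    intro s s'
    simp
  simp only [expect, e3, Finset.mul_sum]
  have e4 : ∀ s : ι → Bool, ∑ s' : ι → Bool, ∑ b, (∏ i, (arms i).stateProb (y i) (s i)) *
      ((∏ i, (arms i).trans (s i) (s' i)) * ((if s j = b then 1 else 0) * F b s')) =
      ∑ b, ∑ s' : ι → Bool, ((∏ i, (arms i).stateProb (y i) (s i)) *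
        (∏ i, (arms i).trans (s i) (s' i)) * (if s j = b then 1 else 0)) * F b s' := by
    intro s
    rw [Finset.sum_comm]
    simp only [mul_assoc]
  simp only [e4]
  rw [Finset.sum_comm]
  refine Finset.sum_congr rfl fun b _ => ?_
  rw [Finset.sum_comm]
  refine Finset.sum_congr rfl fun s' _ => ?_
  rw [← Finset.sum_mul, key b s', mul_assoc]

theorem expect_add (arms : ι → Arm) (y : ι → InfoState) (F G : (ι → Bool) → ℝ) :
    expect arms y (fun s => F s + G s) = expect arms y F + expect arms y G := by
  simp [expect, mul_add, Finset.sum_add_distrib]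

theorem expect_coord (arms : ι → Arm) (y : ι → InfoState) (j : ι) (f : Bool → ℝ) :
    expect arms y (fun s => f (s j)) = ∑ b, (arms j).stateProb (y j) b * f b := by
  have e1 : ∀ s : ι → Bool, (∏ i, (arms i).stateProb (y i) (s i)) * f (s j) =
      ∏ i, ((arms i).stateProb (y i) (s i) * if i = j then f (s i) else 1) := by
    intro s
    rw [Finset.prod_mul_distrib, Finset.prod_ite_eq']
    simp
  simp only [expect, e1]
  rw [sum_prod_eq_prod_sum (fun i b => (arms i).stateProb (y i) b * if i = j then f b else 1)]
  rw [Finset.prod_eq_single j]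
  · simp
  · intro i _ hij
    simpa [hij] using Arm.sum_stateProb (arms i) (y i)
  · simp

theorem expect_zero (arms : ι → Arm) (y : ι → InfoState) : expect arms y (fun _ => 0) = 0 := by
  simp [expect]

/-- Expected reward minus penalty in the next `T` steps, given the history only. -/
noncomputable def totalAfter (arms : ι → Arm) (lam : ℝ) (x : ι → InfoState) (π : Policy ι) (T : ℕ)
    (h : History ι) : ℝ :=
  expect arms (infoAfter x h) (totalFrom arms lam π T h)

theorem expect_step (arms : ι → Arm) (lam : ℝ) (x : ι → InfoState) (π : Policy ι) (T : ℕ)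
    (h : History ι) (c : Option ι) :
    expect arms (infoAfter x h) (fun s => payoff arms lam s c +
        ∑ s' : ι → Bool, (∏ i, (arms i).trans (s i) (s' i)) *
          totalFrom arms lam π T (observe s c :: h) s') =
      lookahead arms lam x (totalAfter arms lam x π T) h c := by
  rw [expect_add]
  cases c with
  | none =>
    simp only [payoff, observe, Option.map_none, lookahead, totalAfter]
    rw [expect_trans, expect_zero, zero_add]
    rfl
  | some j =>
    simp only [payoff, observe, Option.map_some, lookahead, totalAfter]
    rw [expect_coord arms (infoAfter x h) j (fun b => (if b then (arms j).r else 0) - lam),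
      expect_observe_trans arms (infoAfter x h) j
        (fun b s' => totalFrom arms lam π T (some (j, b) :: h) s')]
    simp only [Fintype.sum_bool, Arm.stateProb, infoAfter]
    simp
    ring

theorem totalAfter_succ (arms : ι → Arm) (lam : ℝ) (x : ι → InfoState) (π : Policy ι) (T : ℕ)
    (h : History ι) :
    totalAfter arms lam x π (T + 1) h =
      ∑ c, (π h c).toReal * lookahead arms lam x (totalAfter arms lam x π T) h c := by
  simp only [← expect_step, totalAfter, totalFrom, expect, Finset.mul_sum]
  rw [Finset.sum_comm]
  refine Finset.sum_congr rfl fun c _ => Finset.sum_congr rfl fun s _ => ?_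
  ring

theorem totalAfter_zero (arms : ι → Arm) (lam : ℝ) (x : ι → InfoState) (π : Policy ι)
    (h : History ι) : totalAfter arms lam x π 0 h = 0 := by
  simp [totalAfter, totalFrom, expect]

theorem total_eq_totalAfter (arms : ι → Arm) (lam : ℝ) (x : ι → InfoState) (π : Policy ι)
    (T : ℕ) : total arms lam x π T = totalAfter arms lam x π T [] := rfl

/-- If the potential `Φ` drifts by at most `c` per step under every action, then the total is at
most `c * T` up to a constant. -/
theorem totalAfter_le (arms : ι → Arm) (lam : ℝ) (x : ι → InfoState) (π : Policy ι)
    (Φ : History ι → ℝ) (c m : ℝ) (hm : ∀ h, m ≤ Φ h)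
    (hΦ : ∀ h, ∀ a ∈ (π h).support, lookahead arms lam x Φ h a ≤ c + Φ h) (T : ℕ)
    (h : History ι) : totalAfter arms lam x π T h ≤ Φ h + (c * T - m) := by
  induction T generalizing h with
  | zero => rw [totalAfter_zero]; have := hm h; simp; linarith
  | succ T ih =>
    rw [totalAfter_succ]
    calc _ ≤ ∑ a, (π h a).toReal * (c + Φ h + (c * T - m)) := by
          refine Finset.sum_le_sum fun a _ => ?_
          by_cases ha : a ∈ (π h).support
          · refine mul_le_mul_of_nonneg_left ?_ ENNReal.toReal_nonneg
            refine (lookahead_mono arms lam x ih h a).trans ?_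
            rw [lookahead_add_const]
            linarith [hΦ h a ha]
          · rw [PMF.mem_support_iff, not_not] at ha
            simp [ha]
      _ = _ := by
          rw [← Finset.sum_mul, Policy.sum_toReal]
          push_cast
          ring

theorem le_totalAfter (arms : ι → Arm) (lam : ℝ) (x : ι → InfoState) (π : Policy ι)
    (Φ : History ι → ℝ) (c M : ℝ) (hM : ∀ h, Φ h ≤ M)
    (hΦ : ∀ h, ∀ a ∈ (π h).support, c + Φ h ≤ lookahead arms lam x Φ h a) (T : ℕ)
    (h : History ι) : Φ h + (c * T - M) ≤ totalAfter arms lam x π T h := by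
  induction T generalizing h with
  | zero => rw [totalAfter_zero]; have := hM h; simp; linarith
  | succ T ih =>
    rw [totalAfter_succ]
    calc _ = ∑ a, (π h a).toReal * (c + Φ h + (c * T - M)) := by
          rw [← Finset.sum_mul, Policy.sum_toReal]
          push_cast
          ring
      _ ≤ _ := by
          refine Finset.sum_le_sum fun a _ => ?_
          by_cases ha : a ∈ (π h).support
          · refine mul_le_mul_of_nonneg_left ?_ ENNReal.toReal_nonneg
            refine le_trans ?_ (lookahead_mono arms lam x ih h a)
            rw [lookahead_add_const]
            linarith [hΦ h a ha]
          · rw [PMF.mem_support_iff, not_not] at ha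
            simp [ha]

/-- The total is between two linear functions of the horizon. -/
theorem exists_le_total (arms : ι → Arm) (lam : ℝ) (x : ι → InfoState) (π : Policy ι) :
    ∃ c C : ℝ, ∀ T : ℕ, c * T + C ≤ total arms lam x π T := by
  refine ⟨-|lam|, 0, fun T => ?_⟩
  have := le_totalAfter arms lam x π (fun _ => 0) (-|lam|) 0 (fun _ => le_rfl) ?_ T []
  · rw [total_eq_totalAfter]; linarith
  · rintro h (_ | i) -
    · simp [lookahead]
    · simp only [lookahead]
      have := mul_nonneg ((arms i).belief_mem (infoAfter x h i)).1 (arms i).r_nonneg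
      linarith [le_abs_self lam]

end Bandit

/-! ### Long-run averages of sequences with linear bounds. -/

theorem tendsto_add_div_nat (c C : ℝ) :
    Tendsto (fun T : ℕ => (c * T + C) / (T : ℝ)) atTop (nhds c) := by
  have h : Tendsto (fun T : ℕ => c + C / (T : ℝ)) atTop (nhds (c + 0)) :=
    tendsto_const_nhds.add (tendsto_const_div_atTop_nhds_zero_nat C)
  rw [add_zero] at h
  refine h.congr' ?_
  filter_upwards [eventually_gt_atTop 0] with T hT
  have : (T : ℝ) ≠ 0 := by positivity
  field_simp

/-- The opposite linear bound only supplies boundedness, without which a real `limsup` need not have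
its usual meaning; the two lemmas on `liminf` have the same form. -/
theorem limsup_div_le {u : ℕ → ℝ} {c C c' C' : ℝ} (hl : ∀ T : ℕ, c' * T + C' ≤ u T)
    (hu : ∀ T : ℕ, u T ≤ c * T + C) : limsup (fun T : ℕ => u T / (T : ℝ)) atTop ≤ c := by
  have h1 := tendsto_add_div_nat c C
  have h2 := tendsto_add_div_nat c' C'
  rw [← h1.limsup_eq]
  refine limsup_le_limsup (Eventually.of_forall fun T => ?_) ?_ h1.isBoundedUnder_le
  · exact div_le_div_of_nonneg_right (hu T) (Nat.cast_nonneg T)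
  · refine IsBoundedUnder.isCoboundedUnder_le (h2.isBoundedUnder_ge.mono_ge
      (Eventually.of_forall fun T => ?_))
    exact div_le_div_of_nonneg_right (hl T) (Nat.cast_nonneg T)

theorem liminf_div_le {u : ℕ → ℝ} {c C c' C' : ℝ} (hl : ∀ T : ℕ, c' * T + C' ≤ u T)
    (hu : ∀ T : ℕ, u T ≤ c * T + C) : liminf (fun T : ℕ => u T / (T : ℝ)) atTop ≤ c := by
  have h1 := tendsto_add_div_nat c C
  have h2 := tendsto_add_div_nat c' C'
  rw [← h1.liminf_eq]
  refine liminf_le_liminf (Eventually.of_forall fun T => ?_) ?_ h1.isCoboundedUnder_ge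
  · exact div_le_div_of_nonneg_right (hu T) (Nat.cast_nonneg T)
  · refine h2.isBoundedUnder_ge.mono_ge (Eventually.of_forall fun T => ?_)
    exact div_le_div_of_nonneg_right (hl T) (Nat.cast_nonneg T)

theorem le_liminf_div {u : ℕ → ℝ} {c C c' C' : ℝ} (hl : ∀ T : ℕ, c' * T + C' ≤ u T)
    (hu : ∀ T : ℕ, u T ≤ c * T + C) : c' ≤ liminf (fun T : ℕ => u T / (T : ℝ)) atTop := by
  have h1 := tendsto_add_div_nat c C
  have h2 := tendsto_add_div_nat c' C'
  rw [← h2.liminf_eq]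
  refine liminf_le_liminf (Eventually.of_forall fun T => ?_) h2.isBoundedUnder_ge ?_
  · exact div_le_div_of_nonneg_right (hl T) (Nat.cast_nonneg T)
  · refine IsBoundedUnder.isCoboundedUnder_ge (h1.isBoundedUnder_le.mono_le
      (Eventually.of_forall fun T => ?_))
    exact div_le_div_of_nonneg_right (hu T) (Nat.cast_nonneg T)

/-! ### Monotonicity and concavity of the belief in time. -/

/-- The second eigenvalue of the chain of the arm. -/
noncomputable def Arm.decay (a : Arm) : ℝ := 1 - a.α - a.β

theorem Arm.decay_pos (a : Arm) : 0 < a.decay := by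
  have := a.bursty
  simp only [Arm.decay]; linarith

theorem Arm.decay_lt_one (a : Arm) : a.decay < 1 := by
  have := a.α_pos
  have := a.β_pos
  simp only [Arm.decay]; linarith

theorem Arm.evolve_eq (a : Arm) (ω : ℝ) : a.evolve ω = a.α + a.decay * ω := by
  simp only [Arm.evolve, Arm.decay]; ring

theorem Arm.evolve_iterate_sub (a : Arm) (k : ℕ) (ω ω' : ℝ) :
    a.evolve^[k] ω - a.evolve^[k] ω' = a.decay ^ k * (ω - ω') := by
  induction k with
  | zero => simp
  | succ k ih =>
    simp only [Function.iterate_succ_apply', Arm.evolve_eq] at ih ⊢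
    rw [pow_succ]
    linear_combination a.decay * ih

theorem Arm.goodProb_add (a : Arm) (s : Bool) (t k : ℕ) :
    a.goodProb s (t + k) = a.evolve^[k] (a.goodProb s t) := by
  induction k with
  | zero => rfl
  | succ k ih => rw [Function.iterate_succ_apply', ← ih]; rfl

theorem Arm.goodProb_false_succ (a : Arm) (t : ℕ) :
    a.goodProb false (t + 1) = a.goodProb false t + a.α * a.decay ^ t := by
  induction t with
  | zero => simp [Arm.goodProb, Arm.evolve]
  | succ t ih =>
    rw [Arm.goodProb, ih, a.evolve_eq]
    rw [Arm.goodProb, a.evolve_eq] at ih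
    rw [pow_succ]
    linear_combination ih

theorem Arm.goodProb_true_succ (a : Arm) (t : ℕ) :
    a.goodProb true (t + 1) = a.goodProb true t - a.β * a.decay ^ t := by
  induction t with
  | zero => simp [Arm.goodProb, Arm.evolve]
  | succ t ih =>
    rw [Arm.goodProb, ih, a.evolve_eq]
    rw [Arm.goodProb, a.evolve_eq] at ih
    rw [pow_succ]
    linear_combination ih

theorem Arm.goodProb_false_mono (a : Arm) : Monotone (a.goodProb false) :=
  monotone_nat_of_le_succ fun t => by
    rw [a.goodProb_false_succ]
    have := mul_pos a.α_pos (pow_pos a.decay_pos t)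
    linarith

theorem Arm.goodProb_true_anti (a : Arm) : Antitone (a.goodProb true) :=
  antitone_nat_of_succ_le fun t => by
    rw [a.goodProb_true_succ]
    have := mul_pos a.β_pos (pow_pos a.decay_pos t)
    linarith

theorem Arm.belief_bounds (a : Arm) (x : InfoState) :
    a.α ≤ a.belief x ∧ a.belief x ≤ 1 - a.β := by
  obtain ⟨s, t⟩ := x
  obtain ⟨k, hk⟩ := Nat.exists_eq_succ_of_ne_zero t.ne_zero
  have h := a.goodProb_mem s k
  simp only [Arm.belief, hk, Nat.succ_eq_add_one, Arm.goodProb, a.evolve_eq]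
  have := mul_nonneg a.decay_pos.le h.1
  have := mul_le_mul_of_nonneg_left h.2 a.decay_pos.le
  simp only [Arm.decay] at *
  constructor <;> linarith

theorem Arm.goodProb_false_pos (a : Arm) {t : ℕ} (ht : 1 ≤ t) : 0 < a.goodProb false t :=
  lt_of_lt_of_le (by simpa [Arm.goodProb, Arm.evolve] using a.α_pos) (a.goodProb_false_mono ht)

/-- The increments decrease geometrically, so the sum of the first `t` of them is at least `t` times
the next one. -/
theorem Arm.goodProb_false_concave (a : Arm) (t : ℕ) :
    t * (a.α * a.decay ^ t) ≤ a.goodProb false t := by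
  induction t with
  | zero => simp [Arm.goodProb]
  | succ t ih =>
    rw [a.goodProb_false_succ]
    have h1 : a.α * a.decay ^ (t + 1) ≤ a.α * a.decay ^ t :=
      mul_le_mul_of_nonneg_left
        (pow_le_pow_of_le_one a.decay_pos.le a.decay_lt_one.le (Nat.le_succ t)) a.α_pos.le
    have h2 := mul_le_mul_of_nonneg_left h1 (by positivity : (0 : ℝ) ≤ t + 1)
    push_cast
    linarith

theorem Arm.goodProb_false_div_anti (a : Arm) {t s : ℕ} (ht : 1 ≤ t) (hts : t ≤ s) :
    a.goodProb false s * t ≤ a.goodProb false t * s := by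
  induction s, hts using Nat.le_induction with
  | base => exact le_rfl
  | succ s hs ih =>
    have h1 := a.goodProb_false_concave s
    have hs0 : (0 : ℝ) < s := by exact_mod_cast ht.trans hs
    have ht0 : (0 : ℝ) ≤ t := Nat.cast_nonneg t
    have h2 : a.goodProb false (s + 1) * s ≤ a.goodProb false s * (s + 1) := by
      rw [a.goodProb_false_succ]; linarith
    have h3 := mul_le_mul_of_nonneg_right h2 ht0
    have h4 := mul_le_mul_of_nonneg_right ih (by positivity : (0 : ℝ) ≤ s + 1)
    push_cast
    refine le_of_mul_le_mul_right ?_ hs0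
    linarith

/-! ### The best rate of a waiting policy, as a function of the penalty. -/

/-- Long-run average of the policy that plays after a good observation and `t` steps after a bad
one. -/
noncomputable def Arm.waitRate (a : Arm) (lam : ℝ) (t : ℕ) : ℝ :=
  -- With `v = goodProb false t`, a cycle between bad observations has mean length `t + v / β`, mean
  -- reward `v * r / β` and `1 + v / β` plays on average; numerator and denominator are multiplied
  -- by `β`.
  (a.goodProb false t * (a.r - lam) - lam * a.β) / (t * a.β + a.goodProb false t)

/-- The best long-run average among the waiting policies and the policy that never plays. -/
noncomputable def Arm.optRate (a : Arm) (lam : ℝ) : ℝ := ⨆ t : ℕ+, max 0 (a.waitRate lam t)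

theorem Arm.waitRate_den_pos (a : Arm) {t : ℕ} (ht : 1 ≤ t) :
    0 < t * a.β + a.goodProb false t := by
  have := a.goodProb_false_pos ht
  have := a.β_pos
  positivity

theorem Arm.waitRate_le_div (a : Arm) {lam : ℝ} (hl : 0 ≤ lam) {t : ℕ} (ht : 1 ≤ t) :
    a.waitRate lam t ≤ a.goodProb false t * a.r / (t * a.β + a.goodProb false t) := by
  refine div_le_div_of_nonneg_right ?_ (a.waitRate_den_pos ht).le
  have := mul_nonneg hl (a.goodProb_false_pos ht).le
  have := mul_nonneg hl a.β_pos.le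
  linarith

theorem Arm.waitRate_le (a : Arm) {lam : ℝ} (hl : 0 ≤ lam) {t : ℕ} (ht : 1 ≤ t) :
    a.waitRate lam t ≤ a.r := by
  refine (a.waitRate_le_div hl ht).trans ?_
  rw [div_le_iff₀ (a.waitRate_den_pos ht)]
  have := mul_nonneg a.r_nonneg (mul_nonneg (Nat.cast_nonneg (α := ℝ) t) a.β_pos.le)
  linarith

theorem Arm.bddAbove_waitRate (a : Arm) {lam : ℝ} (hl : 0 ≤ lam) :
    BddAbove (Set.range fun t : ℕ+ => max 0 (a.waitRate lam t)) := by
  refine ⟨a.r, ?_⟩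
  rintro _ ⟨t, rfl⟩
  exact max_le a.r_nonneg (a.waitRate_le hl t.pos)

theorem Arm.waitRate_le_optRate (a : Arm) {lam : ℝ} (hl : 0 ≤ lam) {t : ℕ} (ht : 1 ≤ t) :
    a.waitRate lam t ≤ a.optRate lam :=
  (le_max_right _ _).trans (le_ciSup (a.bddAbove_waitRate hl) ⟨t, ht⟩)

theorem Arm.optRate_nonneg (a : Arm) (lam : ℝ) : 0 ≤ a.optRate lam :=
  Real.iSup_nonneg fun _ => le_max_left _ _

theorem Arm.optRate_le (a : Arm) {lam c : ℝ} (hc : 0 ≤ c)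
    (h : ∀ t : ℕ, 1 ≤ t → a.waitRate lam t ≤ c) : a.optRate lam ≤ c :=
  ciSup_le fun t => max_le hc (h t t.pos)

theorem Arm.waitRate_le_iff (a : Arm) {lam c : ℝ} {t : ℕ} (ht : 1 ≤ t) :
    a.waitRate lam t ≤ c ↔
      a.goodProb false t * (a.r - lam) - lam * a.β ≤ c * (t * a.β + a.goodProb false t) :=
  div_le_iff₀ (a.waitRate_den_pos ht)

theorem Arm.optRate_anti (a : Arm) {l l' : ℝ} (hl : 0 ≤ l) (hll : l ≤ l') :
    a.optRate l' ≤ a.optRate l := by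
  refine a.optRate_le (a.optRate_nonneg l) fun t ht => ?_
  refine le_trans ?_ (a.waitRate_le_optRate hl ht)
  refine div_le_div_of_nonneg_right ?_ (a.waitRate_den_pos ht).le
  have := mul_le_mul_of_nonneg_left hll (a.goodProb_false_pos ht).le
  have := mul_le_mul_of_nonneg_right hll a.β_pos.le
  linarith

/-- A cycle has at most as many plays as steps because `t ≥ 1`, so no rate falls faster than the
penalty rises. -/
theorem Arm.optRate_le_add (a : Arm) {l l' : ℝ} (hl : 0 ≤ l) (hll : l ≤ l') :
    a.optRate l ≤ a.optRate l' + (l' - l) := by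
  refine a.optRate_le (by linarith [a.optRate_nonneg l']) fun t ht => ?_
  have h := (a.waitRate_le_iff ht).1 (a.waitRate_le_optRate (hl.trans hll) ht)
  rw [a.waitRate_le_iff ht]
  have h1 : (1 : ℝ) ≤ t := by exact_mod_cast ht
  have := mul_nonneg (mul_nonneg (sub_nonneg.2 hll) a.β_pos.le) (sub_nonneg.2 h1)
  linarith

/-- Divided by `r - lam`, the numerator of each rate is `v - lam * β / (r - lam)`, which is
nonincreasing in `lam`; hence so is `optRate / (r - lam)`. -/
theorem Arm.optRate_mul_le (a : Arm) {l l' : ℝ} (hl : 0 ≤ l) (hll : l ≤ l') (hr : l' < a.r) :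
    a.optRate l' * (a.r - l) ≤ a.optRate l * (a.r - l') := by
  have h0 : 0 < a.r - l := by linarith
  rw [← le_div_iff₀ h0]
  refine a.optRate_le (div_nonneg (mul_nonneg (a.optRate_nonneg l) (by linarith)) h0.le)
    fun t ht => ?_
  have h := (a.waitRate_le_iff ht).1 (a.waitRate_le_optRate hl ht)
  rw [a.waitRate_le_iff ht, div_mul_eq_mul_div, le_div_iff₀ h0]
  have h1 := mul_le_mul_of_nonneg_right h (by linarith : 0 ≤ a.r - l')
  have h2 := mul_nonneg (mul_nonneg (sub_nonneg.2 hll) a.β_pos.le) a.r_nonneg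
  linarith

theorem Arm.optRate_eq_zero (a : Arm) {l : ℝ} (hl : a.r * (1 - a.β) ≤ l) : a.optRate l = 0 := by
  refine le_antisymm (a.optRate_le le_rfl fun t ht => ?_) (a.optRate_nonneg l)
  rw [a.waitRate_le_iff ht, zero_mul]
  have hv : a.goodProb false t ≤ 1 - a.β := (a.belief_bounds (false, ⟨t, ht⟩)).2
  have hv0 := a.goodProb_false_pos ht
  have hb : a.β < 1 := by linarith [a.α_pos, a.bursty]
  have hl0 : 0 ≤ l := (mul_nonneg a.r_nonneg (by linarith)).trans hl
  rcases le_total a.r l with h | h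
  · have := mul_nonneg hv0.le (sub_nonneg.2 h)
    have := mul_nonneg hl0 a.β_pos.le
    linarith
  · have := mul_le_mul_of_nonneg_right hv (sub_nonneg.2 h)
    linarith

theorem Arm.exists_waitRate_eq (a : Arm) {lam : ℝ} (hl : 0 ≤ lam) (h : 0 < a.optRate lam) :
    ∃ t : ℕ, 1 ≤ t ∧ a.waitRate lam t = a.optRate lam := by
  -- Rates are at most `r / (t * β)`, so beyond `N` they are below half of the supremum, which is
  -- therefore a maximum over finitely many `t`.
  obtain ⟨N, hN⟩ := exists_nat_gt (a.r / (a.β * (a.optRate lam / 2)))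
  have hβ := a.β_pos
  have hN' : ∀ t : ℕ, N ≤ t → 1 ≤ t → a.waitRate lam t ≤ a.optRate lam / 2 := by
    intro t hNt ht
    refine (a.waitRate_le_div hl ht).trans ?_
    rw [div_le_iff₀ (a.waitRate_den_pos ht)]
    rw [div_lt_iff₀ (by positivity)] at hN
    have h1 : a.goodProb false t * a.r ≤ a.r := by
      have := mul_le_mul_of_nonneg_right (a.goodProb_mem false t).2 a.r_nonneg
      linarith
    have h2 : (N : ℝ) ≤ t := by exact_mod_cast hNt
    have h3 := mul_le_mul_of_nonneg_right h2 (by positivity : 0 ≤ a.β * (a.optRate lam / 2))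
    have h4 := mul_nonneg h.le (a.goodProb_mem false t).1
    linarith
  obtain ⟨t₀, ht₀⟩ := exists_lt_of_lt_ciSup (half_lt_self h : a.optRate lam / 2 < ⨆ t : ℕ+, _)
  have ht₀' : a.optRate lam / 2 < a.waitRate lam t₀ := by
    rcases lt_max_iff.1 ht₀ with h1 | h1
    · linarith
    · exact h1
  have hmem : ∀ t : ℕ, 1 ≤ t → a.optRate lam / 2 < a.waitRate lam t → t ∈ Finset.Icc 1 N := by
    intro t ht h1
    refine Finset.mem_Icc.2 ⟨ht, ?_⟩
    by_contra! h2
    exact absurd (hN' t h2.le ht) (not_le.2 h1)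
  obtain ⟨t₁, ht₁, hmax⟩ := Finset.exists_max_image (Finset.Icc 1 N) (a.waitRate lam)
    ⟨_, hmem t₀ t₀.pos ht₀'⟩
  have ht1 := (Finset.mem_Icc.1 ht₁).1
  have h01 := hmax _ (hmem t₀ t₀.pos ht₀')
  refine ⟨t₁, ht1, le_antisymm (a.waitRate_le_optRate hl ht1)
    (a.optRate_le (by linarith) fun t ht => ?_)⟩
  by_cases h2 : a.optRate lam / 2 < a.waitRate lam t
  · exact hmax t (hmem t ht h2)
  · linarith

/-! ### The gain from a good observation and the optimal waiting time. -/

/-- Value of a good observation relative to a bad one, including the reward. -/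
noncomputable def Arm.goodGain (a : Arm) (lam : ℝ) : ℝ := (a.r - lam - a.optRate lam) / a.β

theorem Arm.goodGain_mul (a : Arm) (lam : ℝ) :
    a.goodGain lam * a.β = a.r - lam - a.optRate lam :=
  div_mul_cancel₀ _ a.β_pos.ne'

/-- This is `waitRate ≤ optRate` rearranged. Thus `lam` bounds `goodGain * v_t - optRate * t`, a
concave function of `t`, and `waitTime` is the first `t` that attains it. -/
theorem Arm.goodGain_mul_goodProb_le (a : Arm) {lam : ℝ} (hl : 0 ≤ lam) {t : ℕ} (ht : 1 ≤ t) :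
    a.goodGain lam * a.goodProb false t ≤ lam + a.optRate lam * t := by
  have h := (a.waitRate_le_iff ht).1 (a.waitRate_le_optRate hl ht)
  refine le_of_mul_le_mul_right ?_ a.β_pos
  have := a.goodGain_mul lam
  linear_combination h + a.goodProb false t * this

theorem Arm.exists_goodGain_mul_goodProb_eq (a : Arm) {lam : ℝ} (hl : 0 ≤ lam)
    (h : 0 < a.optRate lam) :
    ∃ t : ℕ, 1 ≤ t ∧ a.goodGain lam * a.goodProb false t = lam + a.optRate lam * t := by
  obtain ⟨t, ht, h⟩ := a.exists_waitRate_eq hl h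
  refine ⟨t, ht, le_antisymm (a.goodGain_mul_goodProb_le hl ht) ?_⟩
  rw [Arm.waitRate, div_eq_iff (a.waitRate_den_pos ht).ne'] at h
  refine le_of_mul_le_mul_right (le_of_eq ?_) a.β_pos
  have := a.goodGain_mul lam
  linear_combination -h - a.goodProb false t * this

theorem Arm.goodGain_nonneg (a : Arm) {lam : ℝ} (hl : 0 ≤ lam) (h : 0 < a.optRate lam) :
    0 ≤ a.goodGain lam := by
  obtain ⟨t, ht, h1⟩ := a.exists_goodGain_mul_goodProb_eq hl h
  by_contra! h2
  have := mul_neg_of_neg_of_pos h2 (a.goodProb_false_pos ht)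
  have : 0 ≤ a.optRate lam * t := by positivity
  linarith

/-- The first waiting time at which playing is optimal after a bad observation. -/
noncomputable def Arm.waitTime (a : Arm) (lam : ℝ) : ℕ :=
  sInf {t : ℕ | 1 ≤ t ∧ a.goodGain lam * a.goodProb false t = lam + a.optRate lam * t}

theorem Arm.waitTime_spec (a : Arm) {lam : ℝ} (hl : 0 ≤ lam) (h : 0 < a.optRate lam) :
    1 ≤ a.waitTime lam ∧ a.goodGain lam * a.goodProb false (a.waitTime lam) =
      lam + a.optRate lam * a.waitTime lam :=
  Nat.sInf_mem (a.exists_goodGain_mul_goodProb_eq hl h)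

theorem Arm.lt_of_lt_waitTime (a : Arm) {lam : ℝ} (hl : 0 ≤ lam) {t : ℕ} (ht : 1 ≤ t)
    (htw : t < a.waitTime lam) :
    a.goodGain lam * a.goodProb false t < lam + a.optRate lam * t :=
  lt_of_le_of_ne (a.goodGain_mul_goodProb_le hl ht) fun h => Nat.notMem_of_lt_sInf htw ⟨ht, h⟩

/-- If one more step of waiting does not pay, then neither do several. -/
theorem Arm.gain_le_of_le_waiting (a : Arm) {lam : ℝ} {t s : ℕ} (hK : 0 ≤ a.goodGain lam)
    (h : a.goodGain lam * (a.α * a.decay ^ t) ≤ a.optRate lam) (hts : t ≤ s) :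
    a.goodGain lam * a.goodProb false s - a.optRate lam * s ≤
      a.goodGain lam * a.goodProb false t - a.optRate lam * t := by
  induction s, hts using Nat.le_induction with
  | base => exact le_rfl
  | succ s hs ih =>
    rw [a.goodProb_false_succ]
    have h1 : a.α * a.decay ^ s ≤ a.α * a.decay ^ t :=
      mul_le_mul_of_nonneg_left
        (pow_le_pow_of_le_one a.decay_pos.le a.decay_lt_one.le hs) a.α_pos.le
    have h2 := mul_le_mul_of_nonneg_left h1 hK
    push_cast
    linarith

theorem Arm.waiting_of_lt_waitTime (a : Arm) {lam : ℝ} (hl : 0 ≤ lam) (h : 0 < a.optRate lam)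
    {t : ℕ} (ht : 1 ≤ t) (htw : t < a.waitTime lam) :
    a.optRate lam < a.goodGain lam * (a.α * a.decay ^ t) := by
  by_contra! h1
  have h2 := a.gain_le_of_le_waiting (a.goodGain_nonneg hl h) h1 htw.le
  have h3 := a.lt_of_lt_waitTime hl ht htw
  have h4 := (a.waitTime_spec hl h).2
  linarith

theorem Arm.gain_le_of_waitTime_le (a : Arm) {lam : ℝ} (hl : 0 ≤ lam) (h : 0 < a.optRate lam)
    {t s : ℕ} (ht : a.waitTime lam ≤ t) (hts : t ≤ s) :
    a.goodGain lam * a.goodProb false s - a.optRate lam * s ≤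
      a.goodGain lam * a.goodProb false t - a.optRate lam * t := by
  have hK := a.goodGain_nonneg hl h
  obtain ⟨h1, h2⟩ := a.waitTime_spec hl h
  -- Equality at `waitTime` and the inequality one step later bound the increment at `waitTime`;
  -- later increments are smaller.
  have h3 := a.goodGain_mul_goodProb_le hl (h1.trans (Nat.le_succ _))
  rw [a.goodProb_false_succ] at h3
  push_cast at h3
  refine a.gain_le_of_le_waiting hK ?_ hts
  have h4 : a.α * a.decay ^ t ≤ a.α * a.decay ^ a.waitTime lam :=
    mul_le_mul_of_nonneg_left
      (pow_le_pow_of_le_one a.decay_pos.le a.decay_lt_one.le ht) a.α_pos.le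
  have h5 := mul_le_mul_of_nonneg_left h4 hK
  linarith

/-! ### A relative value function from optimal stopping. -/

theorem Arm.evolve_mem (a : Arm) {ω : ℝ} (h : ω ∈ Set.Icc (0 : ℝ) 1) :
    a.evolve ω ∈ Set.Icc (0 : ℝ) 1 := by
  have h1 := mul_nonneg a.decay_pos.le h.1
  have h2 := mul_le_mul_of_nonneg_left h.2 a.decay_pos.le
  have := a.α_pos
  have := a.β_pos
  rw [a.evolve_eq]
  simp only [Arm.decay] at *
  constructor <;> linarith

theorem Arm.evolve_iterate_mem (a : Arm) {ω : ℝ} (h : ω ∈ Set.Icc (0 : ℝ) 1) (k : ℕ) :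
    a.evolve^[k] ω ∈ Set.Icc (0 : ℝ) 1 := by
  induction k with
  | zero => exact h
  | succ k ih => rw [Function.iterate_succ_apply']; exact a.evolve_mem ih

/-- Optimal value of the belief `ω` in the problem of stopping the deterministic evolution of the
belief by a play. -/
noncomputable def Arm.stopValue (a : Arm) (lam ω : ℝ) : ℝ :=
  ⨆ k : ℕ, (a.goodGain lam * a.evolve^[k] ω - lam - a.optRate lam * (k + 1))

theorem Arm.stop_le (a : Arm) {lam ω : ℝ} (hK : 0 ≤ a.goodGain lam)
    (hω : ω ∈ Set.Icc (0 : ℝ) 1) (k : ℕ) :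
    a.goodGain lam * a.evolve^[k] ω - lam - a.optRate lam * (k + 1) ≤ a.goodGain lam - lam := by
  have h1 := mul_le_mul_of_nonneg_left (a.evolve_iterate_mem hω k).2 hK
  have h2 := a.optRate_nonneg lam
  have : 0 ≤ a.optRate lam * (k + 1) := by positivity
  linarith

theorem Arm.le_stopValue (a : Arm) {lam ω : ℝ} (hK : 0 ≤ a.goodGain lam)
    (hω : ω ∈ Set.Icc (0 : ℝ) 1) (k : ℕ) :
    a.goodGain lam * a.evolve^[k] ω - lam - a.optRate lam * (k + 1) ≤ a.stopValue lam ω :=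
  le_ciSup (f := fun k : ℕ => a.goodGain lam * a.evolve^[k] ω - lam - a.optRate lam * (k + 1))
    ⟨_, by rintro _ ⟨k, rfl⟩; exact a.stop_le hK hω k⟩ k

theorem Arm.stopValue_bellman (a : Arm) {lam ω : ℝ} (hK : 0 ≤ a.goodGain lam)
    (hω : ω ∈ Set.Icc (0 : ℝ) 1) :
    a.optRate lam + a.stopValue lam ω =
      max (a.goodGain lam * ω - lam) (a.stopValue lam (a.evolve ω)) := by
  refine le_antisymm ?_ (max_le ?_ ?_)
  · rw [← le_sub_iff_add_le']
    refine ciSup_le fun k => ?_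
    rw [le_sub_iff_add_le']
    cases k with
    | zero => exact le_max_of_le_left (by simp)
    | succ k =>
      refine le_max_of_le_right ?_
      have := a.le_stopValue (lam := lam) hK (a.evolve_mem hω) k
      rw [Function.iterate_succ_apply]
      push_cast
      linarith
  · have := a.le_stopValue (lam := lam) hK hω 0
    simp at this
    linarith
  · refine ciSup_le fun k => ?_
    have := a.le_stopValue (lam := lam) hK hω (k + 1)
    rw [Function.iterate_succ_apply] at this
    push_cast at this
    linarith

theorem Arm.continuousOn_stopValue (a : Arm) {lam : ℝ} (hK : 0 ≤ a.goodGain lam) :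
    ContinuousOn (a.stopValue lam) (Set.Icc 0 1) := by
  refine (LipschitzOnWith.of_le_add_mul' (a.goodGain lam) fun ω hω ω' hω' =>
    ciSup_le fun k => ?_).continuousOn
  have h1 := a.le_stopValue (lam := lam) hK hω' k
  have h2 := a.evolve_iterate_sub k ω ω'
  have h3 : a.decay ^ k * (ω - ω') ≤ dist ω ω' := by
    rw [Real.dist_eq]
    refine (le_abs_self _).trans ?_
    rw [abs_mul, abs_of_nonneg (pow_nonneg a.decay_pos.le k)]
    exact mul_le_of_le_one_left (abs_nonneg _) (pow_le_one₀ a.decay_pos.le a.decay_lt_one.le)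
  rw [← h2] at h3
  have h4 := mul_le_mul_of_nonneg_left h3 hK
  simp only [Arm.stopValue] at h1 ⊢
  linarith

/-- This value and the next one make playing worth `goodGain * ω - lam`, so that the stopping
equation `stopValue_bellman` becomes the Bellman equation of the arm. -/
theorem Arm.stopValue_bad (a : Arm) {lam : ℝ} (hl : 0 ≤ lam) (h : 0 < a.optRate lam) :
    a.stopValue lam a.α = 0 := by
  have hK := a.goodGain_nonneg hl h
  have hα : a.goodProb false 1 = a.α := a.belief_bad_one
  have hmem : a.α ∈ Set.Icc (0 : ℝ) 1 := hα ▸ a.goodProb_mem false 1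
  refine le_antisymm (ciSup_le fun k => ?_) ?_
  · have := a.goodGain_mul_goodProb_le hl (t := 1 + k) (by omega)
    rw [a.goodProb_add, hα] at this
    push_cast at this
    linarith
  · obtain ⟨t, ht, h1⟩ := a.exists_goodGain_mul_goodProb_eq hl h
    obtain ⟨k, rfl⟩ := Nat.exists_eq_add_of_le ht
    have := a.le_stopValue (lam := lam) hK hmem k
    rw [a.goodProb_add, hα] at h1
    push_cast at h1
    linarith

theorem Arm.stopValue_good (a : Arm) {lam : ℝ} (hK : 0 ≤ a.goodGain lam) :
    a.stopValue lam (1 - a.β) = a.goodGain lam - a.r := by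
  have hβ : a.goodProb true 1 = 1 - a.β := a.belief_good_one
  have hmem : 1 - a.β ∈ Set.Icc (0 : ℝ) 1 := hβ ▸ a.goodProb_mem true 1
  have hG := a.goodGain_mul lam
  refine le_antisymm (ciSup_le fun k => ?_) ?_
  · have h1 := a.goodProb_true_anti (Nat.le_add_right 1 k)
    rw [a.goodProb_add, hβ] at h1
    have h2 := mul_le_mul_of_nonneg_left h1 hK
    have h3 := mul_nonneg (a.optRate_nonneg lam) (Nat.cast_nonneg (α := ℝ) k)
    linarith
  · have := a.le_stopValue (lam := lam) hK hmem 0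
    simp at this
    linarith

/-- A bounded function of the information with the Bellman inequality for the rate `optRate`. -/
theorem Arm.exists_bellman_le (a : Arm) {lam : ℝ} (hl : 0 ≤ lam) :
    ∃ (V : InfoState → ℝ) (m : ℝ), (∀ x, m ≤ V x) ∧
      (∀ x, a.belief x * (a.r + V (true, 1)) + (1 - a.belief x) * V (false, 1) - lam ≤
        a.optRate lam + V x) ∧
      ∀ x : InfoState, V (x.1, x.2 + 1) ≤ a.optRate lam + V x := by
  rcases (a.optRate_nonneg lam).eq_or_lt with h0 | hpos
  · rw [← h0]
    rcases le_total lam (a.r * (1 - a.β)) with hr | hr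
    · have hG := a.goodGain_mul lam
      rw [← h0] at hG
      have hKr : a.r ≤ a.goodGain lam := by
        refine le_of_mul_le_mul_right ?_ a.β_pos
        linarith
      have hK := a.r_nonneg.trans hKr
      have hg : a.goodGain lam * (1 - a.β) - lam = a.goodGain lam - a.r := by linarith
      -- At rate zero no waiting time need attain equality, and `stopValue` at `α` may be negative.
      -- The value `0` of never playing again takes its place.
      refine ⟨fun x => if x.1 then max 0 (a.goodGain lam * a.belief x - lam) else 0, 0,
        fun x => ?_, fun x => ?_, fun x => ?_⟩
      · dsimp only
        split_ifs
        · exact le_max_left _ _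
        · exact le_rfl
      · simp only [if_true, a.belief_good_one, hg, max_eq_right (sub_nonneg.2 hKr)]
        obtain ⟨s, t⟩ := x
        cases s
        · have := a.goodGain_mul_goodProb_le hl t.pos
          rw [← h0] at this
          simp [Arm.belief]
          linarith
        · simp
          right
          linarith
      · obtain ⟨s, t⟩ := x
        cases s
        · simp
        · simp only [if_true, zero_add]
          refine max_le_max le_rfl ?_
          have := mul_le_mul_of_nonneg_left (a.goodProb_true_anti (Nat.le_succ (t : ℕ))) hK
          simp only [Arm.belief, PNat.add_coe, PNat.one_coe]
          simpa using this
    · refine ⟨fun _ => 0, 0, fun _ => le_rfl, fun x => ?_, fun x => by simp⟩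
      have := mul_le_mul_of_nonneg_left (a.belief_bounds x).2 a.r_nonneg
      linarith
  · have hK := a.goodGain_nonneg hl hpos
    refine ⟨fun x => a.stopValue lam (a.belief x), -lam - a.optRate lam, fun x => ?_, fun x => ?_,
      fun x => ?_⟩
    · have := a.le_stopValue (lam := lam) hK (a.belief_mem x) 0
      have := mul_nonneg hK (a.belief_mem x).1
      simp at *
      linarith
    · have h := a.stopValue_bellman hK (a.belief_mem x)
      dsimp only
      rw [h, a.belief_good_one, a.belief_bad_one, a.stopValue_bad hl hpos, a.stopValue_good hK]
      refine le_max_of_le_left (le_of_eq ?_)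
      ring
    · have h := a.stopValue_bellman hK (a.belief_mem x)
      dsimp only
      rw [h, a.belief_succ]
      exact le_max_right _ _

/-! ### The potential of the optimal waiting policy. -/

/-- Relative values of the optimal waiting policy on the information states that it visits,
extended so that the drift is large enough elsewhere. -/
noncomputable def Arm.waitValue (a : Arm) (lam : ℝ) (x : InfoState) : ℝ :=
  if x.1 then (if x.2 = 1 then a.goodGain lam - a.r else -(lam + a.optRate lam))
  else if (x.2 : ℕ) ≤ a.waitTime lam then a.optRate lam * ((x.2 : ℕ) - 1)
  else a.goodGain lam * a.belief x - lam - a.optRate lam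

theorem Arm.exists_abs_waitValue_le (a : Arm) {lam : ℝ} (hl : 0 ≤ lam) (h : 0 < a.optRate lam) :
    ∃ M, ∀ x, |a.waitValue lam x| ≤ M := by
  have hK := a.goodGain_nonneg hl h
  have hr := a.r_nonneg
  have ht := mul_nonneg h.le (Nat.cast_nonneg (α := ℝ) (a.waitTime lam))
  refine ⟨a.goodGain lam + a.r + lam + a.optRate lam + a.optRate lam * a.waitTime lam,
    fun x => ?_⟩
  rw [Arm.waitValue, abs_le]
  split_ifs with h1 h2 h3
  · constructor <;> linarith
  · constructor <;> linarith
  · have h4 : (1 : ℝ) ≤ (x.2 : ℕ) := by exact_mod_cast x.2.pos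
    have h5 := mul_nonneg h.le (sub_nonneg.2 h4)
    have h6 : ((x.2 : ℕ) : ℝ) ≤ a.waitTime lam := by exact_mod_cast h3
    have h7 := mul_le_mul_of_nonneg_left h6 h.le
    constructor <;> linarith
  · have := mul_nonneg hK (a.belief_mem x).1
    have := mul_le_mul_of_nonneg_left (a.belief_mem x).2 hK
    constructor <;> linarith

theorem Arm.waitValue_bad (a : Arm) {lam : ℝ} (hl : 0 ≤ lam) (h : 0 < a.optRate lam) :
    a.waitValue lam (false, 1) = 0 := by
  have : 1 ≤ a.waitTime lam := (a.waitTime_spec hl h).1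
  simp [Arm.waitValue, this]

theorem Arm.waitValue_of_waitTime_le (a : Arm) {lam : ℝ} (hl : 0 ≤ lam) (h : 0 < a.optRate lam)
    {t : ℕ+} (ht : a.waitTime lam ≤ t) :
    a.waitValue lam (false, t) = a.goodGain lam * a.goodProb false t - lam - a.optRate lam := by
  have hs := (a.waitTime_spec hl h).2
  simp only [Arm.waitValue, Bool.false_eq_true, if_false]
  split_ifs with h1
  · have h2 : (t : ℕ) = a.waitTime lam := le_antisymm h1 ht
    rw [h2, hs]
    ring
  · rfl

theorem Arm.waitValue_play (a : Arm) {lam : ℝ} (hl : 0 ≤ lam) (h : 0 < a.optRate lam)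
    (x : InfoState) :
    a.belief x * (a.r + a.waitValue lam (true, 1)) +
      (1 - a.belief x) * a.waitValue lam (false, 1) = a.goodGain lam * a.belief x := by
  rw [a.waitValue_bad hl h]
  simp only [Arm.waitValue, if_true]
  ring

theorem Arm.waitValue_play_true (a : Arm) {lam : ℝ} (hl : 0 ≤ lam) (h : 0 < a.optRate lam)
    (t : ℕ+) :
    lam + a.optRate lam + a.waitValue lam (true, t) ≤ a.goodGain lam * a.belief (true, t) := by
  by_cases ht : t = 1
  · subst ht
    have := a.goodGain_mul lam
    rw [a.belief_good_one]
    simp only [Arm.waitValue, if_true]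
    linarith
  · have := mul_nonneg (a.goodGain_nonneg hl h) (a.belief_mem (true, t)).1
    simp only [Arm.waitValue, if_true, ht, if_false]
    linarith

theorem Arm.waitValue_play_false (a : Arm) {lam : ℝ} (hl : 0 ≤ lam) (h : 0 < a.optRate lam)
    {t : ℕ+} (ht : a.waitTime lam ≤ t) :
    lam + a.optRate lam + a.waitValue lam (false, t) ≤ a.goodGain lam * a.belief (false, t) := by
  rw [a.waitValue_of_waitTime_le hl h ht]
  simp only [Arm.belief]
  linarith

theorem Arm.waitValue_rest_of_lt (a : Arm) {lam : ℝ}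
    {t : ℕ+} (ht : (t : ℕ) < a.waitTime lam) :
    a.waitValue lam (false, t + 1) = a.optRate lam + a.waitValue lam (false, t) := by
  have : (t : ℕ) + 1 ≤ a.waitTime lam := ht
  simp [Arm.waitValue, this, ht.le]
  ring

theorem Arm.waitValue_rest_false (a : Arm) {lam : ℝ} (hl : 0 ≤ lam) (h : 0 < a.optRate lam)
    (t : ℕ+) :
    a.waitValue lam (false, t) ≤ a.waitValue lam (false, t + 1) := by
  rcases lt_or_ge (t : ℕ) (a.waitTime lam) with h1 | h1
  · rw [a.waitValue_rest_of_lt h1]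
    linarith
  · rw [a.waitValue_of_waitTime_le hl h h1, a.waitValue_of_waitTime_le hl h]
    · have := mul_le_mul_of_nonneg_left (a.goodProb_false_mono (Nat.le_succ (t : ℕ)))
        (a.goodGain_nonneg hl h)
      simp only [PNat.add_coe, PNat.one_coe]
      simpa using this
    · simp only [PNat.add_coe, PNat.one_coe]
      omega

/-- Before `waitTime` playing is premature but is not charged here. Since `v_t / t` decreases,
equality at `waitTime` gives `goodGain * v_t ≥ optRate * t`. -/
theorem Arm.waitValue_play_ge (a : Arm) {lam : ℝ} (hl : 0 ≤ lam) (h : 0 < a.optRate lam)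
    (x : InfoState) :
    a.optRate lam + a.waitValue lam x ≤ a.goodGain lam * a.belief x := by
  obtain ⟨s, t⟩ := x
  cases s
  · rcases lt_or_ge (t : ℕ) (a.waitTime lam) with h1 | h1
    · have h2 := a.goodProb_false_div_anti t.pos h1.le
      have h3 := mul_le_mul_of_nonneg_left h2 (a.goodGain_nonneg hl h)
      obtain ⟨h4, h5⟩ := a.waitTime_spec hl h
      have h6 : (0 : ℝ) < a.waitTime lam := by exact_mod_cast h4
      have h7 := mul_nonneg hl (Nat.cast_nonneg (α := ℝ) (t : ℕ))
      simp only [Arm.waitValue, Bool.false_eq_true, if_false, h1.le, if_true, Arm.belief]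
      refine le_of_mul_le_mul_right ?_ h6
      linear_combination h3 + h7 + ((t : ℕ) : ℝ) * (-h5)
    · have := a.waitValue_play_false hl h h1
      linarith
  · have := a.waitValue_play_true hl h t
    linarith

/-! ### The optimal single-arm average equals `optRate`. -/

theorem Arm.total_le (a : Arm) {lam : ℝ} (hl : 0 ≤ lam) (x : InfoState) (π : Policy Unit) :
    ∃ C : ℝ, ∀ T : ℕ,
      total (fun _ : Unit => a) lam (fun _ => x) π T ≤ a.optRate lam * T + C := by
  obtain ⟨V, m, hm, hp, hw⟩ := a.exists_bellman_le hl
  refine ⟨V x - m, fun T => ?_⟩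
  have := totalAfter_le (fun _ : Unit => a) lam (fun _ => x) π
    (fun h => V (infoAfter (fun _ => x) h ())) (a.optRate lam) m (fun _ => hm _) ?_ T []
  · rw [total_eq_totalAfter]
    simp only [infoAfter] at this
    linarith
  · rintro h (_ | i) -
    · exact hw _
    · simpa [lookahead, infoAfter] using hp (infoAfter (fun _ => x) h ())

theorem Arm.exists_le_total (a : Arm) {lam : ℝ} (hl : 0 ≤ lam) :
    ∃ (x : InfoState) (π : Policy Unit) (C : ℝ), ∀ T : ℕ,
      a.optRate lam * T + C ≤ total (fun _ : Unit => a) lam (fun _ => x) π T := by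
  rcases (a.optRate_nonneg lam).eq_or_lt with h0 | hpos
  · refine ⟨(false, 1), fun _ => PMF.pure none, 0, fun T => ?_⟩
    have := le_totalAfter (fun _ : Unit => a) lam (fun _ => (false, 1)) (fun _ => PMF.pure none)
      (fun _ => 0) 0 0 (fun _ => le_rfl) ?_ T []
    · rw [total_eq_totalAfter, ← h0]
      linarith
    · intro h c hc
      rw [PMF.mem_support_pure_iff] at hc
      simp [hc, lookahead]
  · obtain ⟨M, hM⟩ := a.exists_abs_waitValue_le hl hpos
    let x : Unit → InfoState := fun _ => (false, 1)
    let π : Policy Unit := fun h =>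
      if (infoAfter x h ()).1 = true ∨ a.waitTime lam ≤ (infoAfter x h ()).2 then
        PMF.pure (some ()) else PMF.pure none
    refine ⟨(false, 1), π, a.waitValue lam (false, 1) - M, fun T => ?_⟩
    have := le_totalAfter (fun _ : Unit => a) lam x π
      (fun h => a.waitValue lam (infoAfter x h ())) (a.optRate lam) M
      (fun _ => (abs_le.1 (hM _)).2) ?_ T []
    · rw [total_eq_totalAfter]
      simp only [infoAfter] at this
      linarith
    · intro h c hc
      simp only [π] at hc
      split_ifs at hc with hplay
      · rw [PMF.mem_support_pure_iff] at hc
        subst hc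
        simp only [lookahead, infoAfter, if_true]
        rw [a.waitValue_play hl hpos]
        generalize infoAfter x h () = y at *
        obtain ⟨s, t⟩ := y
        cases s
        · have := a.waitValue_play_false hl hpos (t := t) (by simpa using hplay)
          linarith
        · have := a.waitValue_play_true hl hpos t
          linarith
      · rw [PMF.mem_support_pure_iff] at hc
        subst hc
        simp only [lookahead, infoAfter]
        generalize infoAfter x h () = y at *
        obtain ⟨s, t⟩ := y
        push Not at hplay
        obtain ⟨h1, h2⟩ := hplay
        simp only [ne_eq, Bool.not_eq_true] at h1
        subst h1
        exact (a.waitValue_rest_of_lt h2).ge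

theorem Arm.H_eq_optRate (a : Arm) {lam : ℝ} (hl : 0 ≤ lam) : a.H lam = a.optRate lam := by
  have hle : ∀ c ∈ {c : ℝ | ∃ (x : InfoState) (π : Policy Unit), c = liminf (fun T : ℕ =>
      total (fun _ : Unit => a) lam (fun _ => x) π T / (T : ℝ)) atTop}, c ≤ a.optRate lam := by
    rintro c ⟨x, π, rfl⟩
    obtain ⟨C, hC⟩ := a.total_le hl x π
    obtain ⟨c', C', hC'⟩ := FeedbackMAB.exists_le_total (fun _ : Unit => a) lam (fun _ => x) π
    exact liminf_div_le hC' hC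
  obtain ⟨x, π, C', hC'⟩ := a.exists_le_total hl
  obtain ⟨C, hC⟩ := a.total_le hl x π
  refine le_antisymm (csSup_le ⟨_, x, π, rfl⟩ hle)
    ((le_liminf_div hC' hC).trans (le_csSup ⟨_, hle⟩ ⟨x, π, rfl⟩))

theorem Arm.H_nonneg (a : Arm) (lam : ℝ) : 0 ≤ a.H lam := by
  by_cases hb : BddAbove {c : ℝ | ∃ (x : InfoState) (π : Policy Unit), c = liminf (fun T : ℕ =>
      total (fun _ : Unit => a) lam (fun _ => x) π T / (T : ℝ)) atTop}
  · refine le_csSup hb ⟨(false, 1), fun _ => PMF.pure none, ?_⟩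
    have h0 : ∀ T (h : History Unit) s, totalFrom (fun _ : Unit => a) lam
        (fun _ => PMF.pure none) T h s = 0 := by
      intro T
      induction T with
      | zero => intros; rfl
      | succ T ih =>
        intro h s
        simp only [totalFrom, ih]
        refine Finset.sum_eq_zero fun c _ => ?_
        cases c <;> simp [payoff]
    simp [total, h0]
  -- The supremum of an unbounded set of reals is `0` by convention, so no upper bound is needed for
  -- negative penalties.
  · rw [Arm.H, Real.sSup_of_not_bddAbove hb]

/-! ### Bounds on the Whittle index. -/

theorem pnat_add_one_ne_one (t : ℕ+) : t + 1 ≠ 1 := by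
  intro h
  have := congrArg PNat.val h
  simp at this

theorem Arm.myopic_nonneg (a : Arm) : 0 ≤ a.r * (1 - a.β) :=
  mul_nonneg a.r_nonneg (by linarith [a.α_pos, a.bursty])

theorem Arm.α_mem_Icc (a : Arm) : a.α ∈ Set.Icc a.α (1 - a.β) :=
  ⟨le_rfl, by linarith [a.bursty]⟩

theorem Arm.tendsto_evolve_iterate (a : Arm) (ω : ℝ) :
    Tendsto (fun k => a.evolve^[k] ω) atTop (nhds (a.α / (a.α + a.β))) := by
  have hs : a.α + a.β ≠ 0 := (add_pos a.α_pos a.β_pos).ne'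
  have hfix : Function.IsFixedPt a.evolve (a.α / (a.α + a.β)) := by
    simp only [Function.IsFixedPt, Arm.evolve]
    field_simp
    ring
  have h : ∀ k, a.evolve^[k] ω = a.α / (a.α + a.β) + a.decay ^ k * (ω - a.α / (a.α + a.β)) := by
    intro k
    rw [← a.evolve_iterate_sub, (hfix.iterate k).eq]
    ring
  simp only [h]
  have h0 := (tendsto_pow_atTop_nhds_zero_of_lt_one a.decay_pos.le a.decay_lt_one).mul_const
    (ω - a.α / (a.α + a.β))
  simpa using h0.const_add (a.α / (a.α + a.β))

/-- Here `H = 0`, and on `[α, 1 - β]` a play is worth strictly less than the maximum of `V`. So `V`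
keeps its maximum along the orbit of a maximizer, and by continuity at the stationary belief. But
`V` does not increase under rest, so its value at the stationary belief is also its minimum on the
interval: `V` is constant there and resting strictly beats playing. -/
theorem Arm.not_playOptimal (a : Arm) {lam : ℝ} (hr : a.r * (1 - a.β) < lam) (x : InfoState) :
    ¬ a.PlayOptimal lam x := by
  rintro ⟨V, ⟨hV, hB⟩, hx⟩
  rw [a.H_eq_optRate (a.myopic_nonneg.trans hr.le), a.optRate_eq_zero hr.le] at hB
  have hα := a.α_pos
  have hβ := a.β_pos
  have hb := a.bursty
  have hsub : Set.Icc a.α (1 - a.β) ⊆ Set.Icc (0 : ℝ) 1 :=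
    Set.Icc_subset_Icc hα.le (by linarith)
  have hinv : ∀ ω ∈ Set.Icc a.α (1 - a.β), a.evolve ω ∈ Set.Icc a.α (1 - a.β) := by
    intro ω hω
    have h1 := mul_nonneg a.decay_pos.le (hsub hω).1
    have h2 := mul_le_mul_of_nonneg_left (hsub hω).2 a.decay_pos.le
    rw [a.evolve_eq]
    simp only [Arm.decay] at *
    constructor <;> linarith
  have hinv' : ∀ ω ∈ Set.Icc a.α (1 - a.β), ∀ k, a.evolve^[k] ω ∈ Set.Icc a.α (1 - a.β) := by
    intro ω hω k
    induction k with
    | zero => exact hω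
    | succ k ih => rw [Function.iterate_succ_apply']; exact hinv _ ih
  have hlim : ∀ ω ∈ Set.Icc a.α (1 - a.β),
      Tendsto (fun k => V (a.evolve^[k] ω)) atTop (nhds (V (a.α / (a.α + a.β)))) := by
    intro ω hω
    have ht := a.tendsto_evolve_iterate ω
    have hmem : a.α / (a.α + a.β) ∈ Set.Icc a.α (1 - a.β) :=
      isClosed_Icc.mem_of_tendsto ht (Eventually.of_forall (hinv' ω hω))
    exact (hV _ (hsub hmem)).tendsto.comp (tendsto_nhdsWithin_iff.2
      ⟨ht, Eventually.of_forall fun k => hsub (hinv' ω hω k)⟩)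
  have hge : ∀ ω ∈ Set.Icc a.α (1 - a.β), V (a.α / (a.α + a.β)) ≤ V ω := by
    intro ω hω
    have hanti : Antitone fun k => V (a.evolve^[k] ω) := antitone_nat_of_succ_le fun k => by
      have h1 := hB _ (hsub (hinv' ω hω k))
      rw [zero_add] at h1
      rw [Function.iterate_succ_apply', h1]
      exact le_max_right _ _
    exact hanti.le_of_tendsto (hlim ω hω) 0
  obtain ⟨ω₀, hω₀, hmax⟩ := isCompact_Icc.exists_isMaxOn ⟨_, a.α_mem_Icc⟩ (hV.mono hsub)
  have hmax' : ∀ ω ∈ Set.Icc a.α (1 - a.β), V ω ≤ V ω₀ := fun ω hω => hmax hω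
  have hα' := hmax' _ a.α_mem_Icc
  have hβ' := hmax' (1 - a.β) ⟨by linarith, le_rfl⟩
  have hplay : ∀ ω ∈ Set.Icc a.α (1 - a.β), a.playValue lam V ω < V ω₀ := by
    intro ω hω
    have h1 := mul_le_mul_of_nonneg_left hβ' (hsub hω).1
    have h2 := mul_le_mul_of_nonneg_left hα' (sub_nonneg.2 (hsub hω).2)
    have h3 := mul_le_mul_of_nonneg_left hω.2 a.r_nonneg
    simp only [Arm.playValue]
    linarith
  have hiter : ∀ k, V (a.evolve^[k] ω₀) = V ω₀ := by
    intro k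
    induction k with
    | zero => rfl
    | succ k ih =>
      have h1 := hB _ (hsub (hinv' ω₀ hω₀ k))
      have h2 := hplay _ (hinv' ω₀ hω₀ k)
      rw [zero_add, ih] at h1
      rw [Function.iterate_succ_apply']
      rcases max_choice (a.playValue lam V (a.evolve^[k] ω₀)) (a.restValue V (a.evolve^[k] ω₀))
        with h3 | h3
      · rw [h3] at h1
        exact absurd h1.symm h2.ne
      · rw [h3] at h1
        exact h1.symm
  have hρ : V (a.α / (a.α + a.β)) = V ω₀ := by
    refine tendsto_nhds_unique (hlim ω₀ hω₀) ?_
    simp only [hiter]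
    exact tendsto_const_nhds
  have hxb : a.belief x ∈ Set.Icc a.α (1 - a.β) := a.belief_bounds x
  have h1 := hplay _ hxb
  have h2 := hge _ (hinv _ hxb)
  rw [hρ] at h2
  exact absurd (h2.trans hx) (not_le.2 h1)

theorem Arm.whittleIndex_le (a : Arm) (x : InfoState) : a.whittleIndex x ≤ a.r * (1 - a.β) :=
  Real.sSup_le (fun _ h => not_lt.1 fun hlt => a.not_playOptimal hlt x h) a.myopic_nonneg

theorem Arm.PlayOptimal.le_whittleIndex {a : Arm} {lam : ℝ} {x : InfoState}
    (h : a.PlayOptimal lam x) : lam ≤ a.whittleIndex x :=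
  le_csSup ⟨_, fun _ h => not_lt.1 fun hlt => a.not_playOptimal hlt x h⟩ h

/-- Playing after a bad observation is optimal only if one more step of waiting does not pay. -/
theorem Arm.PlayOptimal.waiting_le {a : Arm} {lam : ℝ} {t : ℕ+}
    (h : a.PlayOptimal lam (false, t)) :
    a.α * a.decay ^ (t : ℕ) * (a.r - lam - a.H lam) ≤ a.β * a.H lam := by
  obtain ⟨V, ⟨-, hB⟩, hx⟩ := h
  -- Let `K = r + V (1 - β) - V α`. Playing in `(g, 1)` gives `β * K ≥ r - lam - H`. Playing now
  -- being no worse than resting once and then playing gives `K * α * decay ^ t ≤ H`. The two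
  -- combine without `K`.
  have h1 := (le_max_left _ _).trans (hB _ (a.belief_mem (true, 1))).ge
  have h2 := (le_max_left _ _).trans (hB _ (a.belief_mem (false, t + 1))).ge
  rw [a.belief_good_one] at h1
  rw [Arm.restValue, ← a.belief_succ] at hx
  have h3 : a.belief (false, t + 1) = a.belief (false, t) + a.α * a.decay ^ (t : ℕ) :=
    a.goodProb_false_succ t
  simp only [Arm.playValue] at h1 h2 hx
  have h4 := h2.trans (add_le_add_right hx (a.H lam))
  have hpos : 0 ≤ a.α * a.decay ^ (t : ℕ) := (mul_pos a.α_pos (pow_pos a.decay_pos t)).le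
  rw [h3] at h4
  have h5 : a.r - lam - a.H lam ≤ a.β * (a.r + V (1 - a.β) - V a.α) := by linarith
  have h6 := mul_le_mul_of_nonneg_left h5 hpos
  have h7 : a.α * a.decay ^ (t : ℕ) * (a.r + V (1 - a.β) - V a.α) ≤ a.H lam := by linarith
  have h8 := mul_le_mul_of_nonneg_left h7 a.β_pos.le
  linarith

theorem Arm.whittleIndex_bad_lt (a : Arm) {lam : ℝ} (hl : 0 < lam) (hr : lam ≤ a.r * (1 - a.β))
    {t : ℕ+} (h : a.β * a.optRate lam <
      a.α * a.decay ^ (t : ℕ) * (a.r - lam - a.optRate lam)) :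
    a.whittleIndex (false, t) < lam := by
  set p := a.α * a.decay ^ (t : ℕ) with hp
  have hp0 : 0 < p := mul_pos a.α_pos (pow_pos a.decay_pos t)
  have hβ := a.β_pos
  have hp1 : p + a.β ≤ 1 := by
    have : p ≤ a.α :=
      mul_le_of_le_one_right a.α_pos.le (pow_le_one₀ a.decay_pos.le a.decay_lt_one.le)
    linarith [a.bursty]
  have hr0 : 0 < a.r := by
    refine a.r_nonneg.lt_of_ne fun h0 => ?_
    rw [← h0, zero_mul] at hr
    linarith
  have hrr : a.r * (1 - a.β) < a.r := by
    have := mul_pos hr0 hβ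
    linarith
  set d := p * (a.r - lam - a.optRate lam) - a.β * a.optRate lam with hd
  have hd0 : 0 < d := sub_pos.2 h
  -- A positive margin is needed because the index is a supremum. The bound by `lam` keeps the
  -- penalties under consideration nonnegative; the bound by `d / 2` keeps the condition violated
  -- just below `lam`.
  have he0 : 0 < min lam (d / 2) := lt_min hl (half_pos hd0)
  have hel : min lam (d / 2) ≤ lam := min_le_left _ _
  have hed : min lam (d / 2) ≤ d / 2 := min_le_right _ _
  refine lt_of_le_of_lt (b := lam - min lam (d / 2)) ?_ (by linarith)
  refine Real.sSup_le (fun l' hl' => ?_) (by linarith)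
  by_contra! hlt
  have hl0 : 0 ≤ l' := by linarith
  have hlr : l' ≤ a.r * (1 - a.β) := not_lt.1 fun h => a.not_playOptimal h _ hl'
  have hw := hl'.waiting_le
  rw [a.H_eq_optRate hl0] at hw
  rcases le_total l' lam with hll | hll
  · have h1 := a.optRate_le_add hl0 hll
    have h2 := mul_le_mul_of_nonneg_left h1 (by linarith : 0 ≤ p + a.β)
    have h3 := mul_le_mul_of_nonneg_right hp1 (sub_nonneg.2 hll)
    have h4 := mul_nonneg hp0.le (sub_nonneg.2 hll)
    linarith
  -- The necessary condition is a lower bound on `H / (r - lam)`, a nonincreasing ratio; once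
  -- violated, it stays violated for larger penalties.
  · have h1 := a.optRate_mul_le hl.le hll (by linarith)
    have h2 := mul_le_mul_of_nonneg_left h1 (by linarith : 0 ≤ p + a.β)
    have h3 := mul_lt_mul_of_pos_right h (by linarith : 0 < a.r - l')
    have h4 := mul_le_mul_of_nonneg_right hw (by linarith : 0 ≤ a.r - lam)
    linarith

theorem Arm.playOptimal_of_forall (a : Arm) {lam : ℝ} (hl : 0 ≤ lam) (h : 0 < a.optRate lam)
    {x : InfoState} (hx : ∀ s : ℕ, (x.2 : ℕ) ≤ s →
      a.goodGain lam * a.goodProb x.1 s - a.optRate lam * s ≤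
        a.goodGain lam * a.goodProb x.1 x.2 - a.optRate lam * (x.2 : ℕ)) :
    a.PlayOptimal lam x := by
  have hK := a.goodGain_nonneg hl h
  have hplay : ∀ ω, a.playValue lam (a.stopValue lam) ω = a.goodGain lam * ω - lam := by
    intro ω
    rw [Arm.playValue, a.stopValue_bad hl h, a.stopValue_good hK]
    ring
  refine ⟨a.stopValue lam, ⟨a.continuousOn_stopValue hK, fun ω hω => ?_⟩, ?_⟩
  · rw [a.H_eq_optRate hl, hplay, a.stopValue_bellman hK hω]
    rfl
  · rw [hplay]
    refine ciSup_le fun k => ?_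
    have h1 := hx (x.2 + (k + 1)) (Nat.le_add_right _ _)
    rw [a.goodProb_add, Function.iterate_succ_apply] at h1
    simp only [Arm.belief]
    push_cast at h1
    linarith

theorem Arm.playOptimal_bad (a : Arm) {lam : ℝ} (hl : 0 ≤ lam) (h : 0 < a.optRate lam) {t : ℕ+}
    (ht : a.waitTime lam ≤ t) : a.PlayOptimal lam (false, t) :=
  a.playOptimal_of_forall hl h fun _ hs => a.gain_le_of_waitTime_le hl h ht hs

theorem Arm.playOptimal_good (a : Arm) {lam : ℝ} (hl : 0 ≤ lam) (h : 0 < a.optRate lam)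
    (t : ℕ+) : a.PlayOptimal lam (true, t) := by
  refine a.playOptimal_of_forall hl h fun s hs => ?_
  have h1 := mul_le_mul_of_nonneg_left (a.goodProb_true_anti hs) (a.goodGain_nonneg hl h)
  have h2 : (((t : ℕ) : ℝ)) ≤ s := by exact_mod_cast hs
  have h3 := mul_le_mul_of_nonneg_left h2 h.le
  linarith

/-! ### Single-arm potentials for the Threshold-Whittle rule. -/

/-- A potential whose drift is large enough under the Threshold-Whittle rule. -/
structure Arm.IsPotential (a : Arm) (lam : ℝ) (φ : InfoState → ℝ) (M : ℝ) : Prop where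
  bound : ∀ x, |φ x| ≤ M
  top : lam ≤ a.r * (1 - a.β) → lam + φ (true, 1) ≤
    a.belief (true, 1) * (a.r + φ (true, 1)) + (1 - a.belief (true, 1)) * φ (false, 1)
  play : ∀ x, a.optRate lam + φ x ≤
    a.belief x * (a.r + φ (true, 1)) + (1 - a.belief x) * φ (false, 1)
  play_index : ∀ x, lam ≤ a.whittleIndex x → lam + φ x ≤
    a.belief x * (a.r + φ (true, 1)) + (1 - a.belief x) * φ (false, 1)
  rest : ∀ x : InfoState, ¬ (x = (true, 1) ∧ lam ≤ a.r * (1 - a.β)) → φ x ≤ φ (x.1, x.2 + 1)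
  rest_index : ∀ x : InfoState, ¬ (x = (true, 1) ∧ lam ≤ a.r * (1 - a.β)) →
    a.whittleIndex x < lam → a.optRate lam + φ x ≤ φ (x.1, x.2 + 1)

theorem Arm.isPotential_waitValue (a : Arm) {lam : ℝ} (hl : 0 ≤ lam) (h : 0 < a.optRate lam) :
    ∃ M, a.IsPotential lam (a.waitValue lam) M := by
  obtain ⟨M, hM⟩ := a.exists_abs_waitValue_le hl h
  have hr : lam ≤ a.r * (1 - a.β) := by
    by_contra! hr
    exact h.ne' (a.optRate_eq_zero hr.le)
  refine ⟨M, hM, fun _ => ?_, fun x => ?_, fun x hx => ?_, fun x hx => ?_, fun x hx hW => ?_⟩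
  · rw [a.waitValue_play hl h]
    have := a.waitValue_play_true hl h 1
    linarith
  · rw [a.waitValue_play hl h]
    exact a.waitValue_play_ge hl h x
  · rw [a.waitValue_play hl h]
    obtain ⟨s, t⟩ := x
    cases s
    · rcases lt_or_ge (t : ℕ) (a.waitTime lam) with ht | ht
      -- A strict bound below `lam` is available only for `lam > 0`; for `lam = 0` the drift
      -- `optRate` of any play already suffices.
      · rcases hl.eq_or_lt with h0 | hl'
        · have := a.waitValue_play_ge hl h (false, t)
          linarith
        · refine absurd hx (not_le.2 (a.whittleIndex_bad_lt hl' hr ?_))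
          have h1 := mul_lt_mul_of_pos_left (a.waiting_of_lt_waitTime hl h t.pos ht) a.β_pos
          rw [← a.goodGain_mul]
          linarith
      · have := a.waitValue_play_false hl h ht
        linarith
    · have := a.waitValue_play_true hl h t
      linarith
  · obtain ⟨s, t⟩ := x
    cases s
    · exact a.waitValue_rest_false hl h t
    · have ht : t ≠ 1 := fun ht => hx ⟨by rw [ht], hr⟩
      simp only [Arm.waitValue, if_true, ht, pnat_add_one_ne_one, if_false, le_refl]
  · obtain ⟨s, t⟩ := x
    cases s
    · rcases lt_or_ge (t : ℕ) (a.waitTime lam) with ht | ht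
      · exact (a.waitValue_rest_of_lt ht).ge
      · exact absurd (a.playOptimal_bad hl h ht).le_whittleIndex (not_le.2 hW)
    · exact absurd (a.playOptimal_good hl h t).le_whittleIndex (not_le.2 hW)

/-- When the rate is zero, waiting never stops paying after a bad observation, as if `waitTime` were
infinite. For `lam > 0` every bad state then has index below `lam`. -/
theorem Arm.exists_isPotential_of_optRate_eq_zero (a : Arm) {lam : ℝ} (hl : 0 ≤ lam)
    (h : a.optRate lam = 0) (hr : lam ≤ a.r * (1 - a.β)) :
    ∃ φ M, a.IsPotential lam φ M := by
  have hG := a.goodGain_mul lam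
  rw [h] at hG
  have hKr : a.r ≤ a.goodGain lam := by
    refine le_of_mul_le_mul_right ?_ a.β_pos
    linarith
  have hr0 := a.r_nonneg
  have hK := hr0.trans hKr
  let φ : InfoState → ℝ := fun x =>
    if x.1 then (if x.2 = 1 then a.goodGain lam - a.r else -lam) else 0
  have hφ : ∀ x, a.belief x * (a.r + φ (true, 1)) + (1 - a.belief x) * φ (false, 1) =
      a.goodGain lam * a.belief x := by
    intro x
    simp only [φ, if_true]
    simp
    ring
  have hgood : ∀ t : ℕ+, lam + φ (true, t) ≤ a.goodGain lam * a.belief (true, t) := by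
    intro t
    by_cases ht : t = 1
    · subst ht
      rw [a.belief_good_one]
      simp only [φ, if_true]
      linarith
    · have := mul_nonneg hK (a.belief_mem (true, t)).1
      simp only [φ, if_true, ht, if_false]
      linarith
  have hrest : ∀ x : InfoState, ¬ (x = (true, 1) ∧ lam ≤ a.r * (1 - a.β)) →
      φ x ≤ φ (x.1, x.2 + 1) := by
    intro x hx
    obtain ⟨s, t⟩ := x
    cases s
    · exact le_rfl
    · have ht : t ≠ 1 := fun ht => hx ⟨by rw [ht], hr⟩
      simp only [φ, if_true, ht, pnat_add_one_ne_one, if_false, le_refl]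
  refine ⟨φ, lam + a.goodGain lam, fun x => ?_, fun _ => ?_, fun x => ?_, fun x hx => ?_, hrest,
    fun x hx _ => ?_⟩
  · simp only [φ]
    rw [abs_le]
    split_ifs <;> constructor <;> linarith
  · rw [hφ]
    exact hgood 1
  · rw [hφ, h]
    have := mul_nonneg hK (a.belief_mem x).1
    obtain ⟨s, t⟩ := x
    cases s
    · simpa [φ] using this
    · have := hgood t
      linarith
  · rw [hφ]
    obtain ⟨s, t⟩ := x
    cases s
    · have h0 : φ (false, t) = 0 := by simp [φ]
      rw [h0, add_zero]
      rcases hl.eq_or_lt with h1 | hl'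
      · rw [← h1] at hK ⊢
        exact mul_nonneg hK (a.belief_mem _).1
      · refine absurd hx (not_le.2 (a.whittleIndex_bad_lt hl' hr ?_))
        rw [h, mul_zero, sub_zero]
        refine mul_pos (mul_pos a.α_pos (pow_pos a.decay_pos t)) (sub_pos.2 ?_)
        have hr1 : 0 < a.r := hr0.lt_of_ne fun h2 => by
          rw [← h2, zero_mul] at hr
          linarith
        have := mul_pos hr1 a.β_pos
        linarith
    · exact hgood t
  · rw [h, zero_add]
    exact hrest x hx

theorem Arm.exists_isPotential (a : Arm) {lam : ℝ} (hl : 0 ≤ lam) :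
    ∃ φ M, a.IsPotential lam φ M := by
  rcases (a.optRate_nonneg lam).eq_or_lt with h | h
  · rcases le_or_gt lam (a.r * (1 - a.β)) with hr | hr
    · exact a.exists_isPotential_of_optRate_eq_zero hl h.symm hr
    · refine ⟨fun _ => 0, 0, fun _ => by simp, fun h1 => absurd h1 (not_le.2 hr), fun x => ?_,
        fun x hx => absurd ((a.whittleIndex_le x).trans_lt hr) (not_lt.2 hx), fun _ _ => le_rfl,
        fun x _ _ => by simp [← h]⟩
      have := mul_nonneg (a.belief_mem x).1 a.r_nonneg
      simpa [← h] using this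
  · obtain ⟨M, hM⟩ := a.isPotential_waitValue hl h
    exact ⟨_, M, hM⟩

/-! ### Drift bounds for all arms together. -/

/-- Only the arm that was just played can be in the state `(g, 1)`. -/
theorem infoAfter_eq_good_one_unique {ι : Type} [DecidableEq ι] (x : ι → InfoState) {h : History ι} (hne : h ≠ []) {i j : ι}
    (hi : infoAfter x h i = (true, 1)) (hj : infoAfter x h j = (true, 1)) : i = j := by
  match h, hne with
  | none :: h, _ =>
    exact absurd (congrArg Prod.snd hi) (pnat_add_one_ne_one _)
  | some (k, s) :: h, _ =>
    have key : ∀ i, infoAfter x (some (k, s) :: h) i = (true, 1) → i = k := by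
      intro i hi
      by_contra hik
      simp only [infoAfter, hik, if_false] at hi
      exact pnat_add_one_ne_one _ (congrArg Prod.snd hi)
    rw [key i hi, key j hj]

section Bandit

variable {ι : Type} [Fintype ι] [DecidableEq ι]

theorem lookahead_sum_some (arms : ι → Arm) (lam : ℝ) (x : ι → InfoState)
    (φ : ι → InfoState → ℝ) (h : History ι) (j : ι) :
    lookahead arms lam x (fun h => ∑ i, φ i (infoAfter x h i)) h (some j) =
      (arms j).belief (infoAfter x h j) * ((arms j).r + φ j (true, 1)) +
        (1 - (arms j).belief (infoAfter x h j)) * φ j (false, 1) - lam +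
        ∑ i ∈ Finset.univ.erase j, φ i ((infoAfter x h i).1, (infoAfter x h i).2 + 1) := by
  have e : ∀ s, ∑ i, φ i (infoAfter x (some (j, s) :: h) i) = φ j (s, 1) +
      ∑ i ∈ Finset.univ.erase j, φ i ((infoAfter x h i).1, (infoAfter x h i).2 + 1) := by
    intro s
    rw [← Finset.add_sum_erase _ _ (Finset.mem_univ j)]
    congr 1
    · simp [infoAfter]
    · refine Finset.sum_congr rfl fun i hi => ?_
      simp [infoAfter, Finset.ne_of_mem_erase hi]
  simp only [lookahead, e]
  ring

theorem le_lookahead_of_thresholdWhittleChoice (arms : ι → Arm) {lam : ℝ}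
    (hlam : lam = ∑ i, (arms i).optRate lam) (x : ι → InfoState)
    {φ : ι → InfoState → ℝ} {M : ι → ℝ} (hφ : ∀ i, (arms i).IsPotential lam (φ i) (M i))
    {h : History ι} (hne : h ≠ []) {j : ι}
    (hj : ThresholdWhittleChoice arms lam (infoAfter x h) j) :
    lam + ∑ i, φ i (infoAfter x h i) ≤
      lookahead arms 0 x (fun h => ∑ i, φ i (infoAfter x h i)) h (some j) := by
  rw [lookahead_sum_some, ← Finset.add_sum_erase _ _ (Finset.mem_univ j)]
  set y := infoAfter x h
  rcases hj with ⟨h1, h2⟩ | ⟨h1, h2⟩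
  · have h3 := (hφ j).top (by linarith)
    have h4 : ∑ i ∈ Finset.univ.erase j, φ i (y i) ≤
        -- Resting may lose potential only in `(g, 1)`, and after the first step the played arm is
        -- the only one that can be there.
        ∑ i ∈ Finset.univ.erase j, φ i ((y i).1, (y i).2 + 1) :=
      Finset.sum_le_sum fun i hi => (hφ i).rest _ fun h5 =>
        Finset.ne_of_mem_erase hi (infoAfter_eq_good_one_unique x hne h5.1 h1)
    rw [h1]
    linarith
  · rcases le_or_gt lam ((arms j).whittleIndex (y j)) with h3 | h3
    · have h4 := (hφ j).play_index _ h3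
      have h5 : ∑ i ∈ Finset.univ.erase j, φ i (y i) ≤
          ∑ i ∈ Finset.univ.erase j, φ i ((y i).1, (y i).2 + 1) :=
        Finset.sum_le_sum fun i hi => (hφ i).rest _ (h1 i)
      linarith
    · have h4 := (hφ j).play (y j)
      have h5 : ∑ i ∈ Finset.univ.erase j, ((arms i).optRate lam + φ i (y i)) ≤
          ∑ i ∈ Finset.univ.erase j, φ i ((y i).1, (y i).2 + 1) :=
        Finset.sum_le_sum fun i hi => (hφ i).rest_index _ (h1 i) ((h2 i).trans_lt h3)
      rw [Finset.sum_add_distrib] at h5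
      rw [← Finset.add_sum_erase _ _ (Finset.mem_univ j)] at hlam
      linarith

theorem exists_le_total_of_isThresholdWhittle (arms : ι → Arm) {lam : ℝ}
    (hlam : lam = ∑ i, (arms i).optRate lam) (hl : 0 ≤ lam) (x : ι → InfoState) (π : Policy ι)
    (hπ : IsThresholdWhittle arms lam x π) :
    ∃ C : ℝ, ∀ T : ℕ, lam * T + C ≤ total arms 0 x π T := by
  choose φ M hφ using fun i => (arms i).exists_isPotential hl
  have hM : ∀ h, |∑ i, φ i (infoAfter x h i)| ≤ ∑ i, M i := fun h =>
    (Finset.abs_sum_le_sum_abs _ _).trans (Finset.sum_le_sum fun i _ => (hφ i).bound _)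
  have hM0 : 0 ≤ ∑ i, M i := (abs_nonneg _).trans (hM [])
  -- The initial information may put several arms in `(g, 1)`. A low enough value at the empty
  -- history makes the first drift at least `lam` in any case; later histories are never empty.
  let Φ : History ι → ℝ := fun h =>
    if h = [] then -(lam + ∑ i, M i) else ∑ i, φ i (infoAfter x h i)
  have hcons : ∀ h : History ι, ∀ c, lookahead arms 0 x Φ h c =
      lookahead arms 0 x (fun h => ∑ i, φ i (infoAfter x h i)) h c := by
    intro h c
    cases c <;> simp [lookahead, Φ]
  refine ⟨Φ [] - ∑ i, M i, fun T => ?_⟩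
  have := le_totalAfter arms 0 x π Φ lam (∑ i, M i) ?_ ?_ T []
  · rw [total_eq_totalAfter]
    linarith
  · intro h
    simp only [Φ]
    split_ifs
    · linarith
    · exact (abs_le.1 (hM h)).2
  · intro h c hc
    rw [hcons]
    obtain ⟨j, rfl, hj⟩ := hπ h c hc
    by_cases hne : h = []
    · simp only [Φ, hne, if_true, lookahead]
      have h1 := (abs_le.1 (hM [some (j, true)])).1
      have h2 := (abs_le.1 (hM [some (j, false)])).1
      obtain ⟨hb0, hb1⟩ := (arms j).belief_mem (infoAfter x [] j)
      have h3 := mul_le_mul_of_nonneg_left h1 hb0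
      have h4 := mul_le_mul_of_nonneg_left h2 (sub_nonneg.2 hb1)
      have h5 := mul_nonneg hb0 (arms j).r_nonneg
      linarith
    · simp only [Φ, hne, if_false]
      exact le_lookahead_of_thresholdWhittleChoice arms hlam x hφ hne hj

/-- Weak duality: relaxing the constraint of one play per step with the multiplier `lam` bounds
the reward of every policy. -/
theorem exists_total_le (arms : ι → Arm) {lam : ℝ} (hl : 0 ≤ lam) (x : ι → InfoState)
    (σ : Policy ι) :
    ∃ C : ℝ, ∀ T : ℕ, total arms 0 x σ T ≤ (lam + ∑ i, (arms i).optRate lam) * T + C := by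
  choose V m hm hp hw using fun i => (arms i).exists_bellman_le hl
  refine ⟨∑ i, V i (x i) - ∑ i, m i, fun T => ?_⟩
  have := totalAfter_le arms 0 x σ (fun h => ∑ i, V i (infoAfter x h i))
    (lam + ∑ i, (arms i).optRate lam) (∑ i, m i)
    (fun _ => Finset.sum_le_sum fun i _ => hm i _) ?_ T []
  · rw [total_eq_totalAfter]
    simp only [infoAfter] at this
    linarith
  · rintro h (_ | j) -
    · have h1 : ∑ i, V i ((infoAfter x h i).1, (infoAfter x h i).2 + 1) ≤
          ∑ i, ((arms i).optRate lam + V i (infoAfter x h i)) :=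
        Finset.sum_le_sum fun i _ => hw i _
      rw [Finset.sum_add_distrib] at h1
      simp only [lookahead, infoAfter]
      linarith
    · have h1 : ∑ i ∈ Finset.univ.erase j, V i ((infoAfter x h i).1, (infoAfter x h i).2 + 1) ≤
          ∑ i ∈ Finset.univ.erase j, ((arms i).optRate lam + V i (infoAfter x h i)) :=
        Finset.sum_le_sum fun i _ => hw i _
      have h2 := hp j (infoAfter x h j)
      rw [Finset.sum_add_distrib] at h1
      rw [lookahead_sum_some, ← Finset.add_sum_erase _ (fun i => V i (infoAfter x h i))
        (Finset.mem_univ j), ← Finset.add_sum_erase _ (fun i => (arms i).optRate lam)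
        (Finset.mem_univ j)]
      linarith

end Bandit

/-! ### The fixed point and the approximation ratio. -/

theorem existsUnique_eq_sum_H {ι : Type} [Fintype ι] (arms : ι → Arm) :
    ∃! lam : ℝ, lam = ∑ i, (arms i).H lam := by
  have hnn : ∀ l : ℝ, l = ∑ i, (arms i).H l → 0 ≤ l := fun l h =>
    h ▸ Finset.sum_nonneg fun i _ => (arms i).H_nonneg l
  have hH : ∀ l : ℝ, 0 ≤ l → ∑ i, (arms i).H l = ∑ i, (arms i).optRate l := fun l hl =>
    Finset.sum_congr rfl fun i _ => (arms i).H_eq_optRate hl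
  have hanti : ∀ l l' : ℝ, 0 ≤ l → l ≤ l' →
      ∑ i, (arms i).optRate l' ≤ ∑ i, (arms i).optRate l := fun l l' hl hll =>
    Finset.sum_le_sum fun i _ => (arms i).optRate_anti hl hll
  have hcont : ContinuousOn (fun l => ∑ i, (arms i).optRate l) (Set.Ici 0) := by
    refine continuousOn_finsetSum _ fun i _ => ?_
    refine (LipschitzOnWith.of_le_add_mul' 1 fun l hl l' hl' => ?_).continuousOn
    rw [one_mul, Real.dist_eq]
    rcases le_total l l' with h | h
    · have := (arms i).optRate_le_add hl h
      rw [abs_of_nonpos (sub_nonpos.2 h)]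
      linarith
    · have := (arms i).optRate_anti hl' h
      have := abs_nonneg (l - l')
      linarith
  have h0 : 0 ≤ ∑ i, (arms i).optRate 0 := Finset.sum_nonneg fun i _ => (arms i).optRate_nonneg 0
  -- On `[0, ∞)` the sum is continuous and nonincreasing, so `l` minus the sum is at most `0` at `0`
  -- and at least `0` at the value of the sum at `0`.
  obtain ⟨l, hl, hl'⟩ := intermediate_value_Icc h0
    ((continuousOn_id.sub hcont).mono Set.Icc_subset_Ici_self)
    (show (0 : ℝ) ∈ _ from ⟨by simpa using h0, by simpa using hanti 0 _ le_rfl h0⟩)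
  have hl'' : l - ∑ i, (arms i).optRate l = 0 := hl'
  refine ⟨l, ?_, fun m hm => ?_⟩
  · change l = _
    rw [hH l hl.1]
    linarith
  · have hm0 := hnn m hm
    have hm' := hm.trans (hH m hm0)
    rcases le_total l m with h | h
    · have := hanti l m hl.1 h
      linarith
    · have := hanti m l hm0 h
      linarith

end FeedbackMAB

theorem mainTheorem3 {n : ℕ} (arms : Fin n → FeedbackMAB.Arm)
    (x : Fin n → FeedbackMAB.InfoState) :
    (∃! lam : ℝ, lam = ∑ i, (arms i).H lam) ∧
    ∀ lam : ℝ, lam = ∑ i, (arms i).H lam →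
      ∀ π : FeedbackMAB.Policy (Fin n), FeedbackMAB.IsThresholdWhittle arms lam x π →
        ∀ σ : FeedbackMAB.Policy (Fin n),
          Filter.limsup (FeedbackMAB.averageReward arms x σ) Filter.atTop ≤
            2 * Filter.liminf (FeedbackMAB.averageReward arms x π) Filter.atTop := by
  refine ⟨FeedbackMAB.existsUnique_eq_sum_H arms, fun lam hlam π hπ σ => ?_⟩
  have hl : 0 ≤ lam := hlam ▸ Finset.sum_nonneg fun i _ => (arms i).H_nonneg lam
  have hlam' : lam = ∑ i, (arms i).optRate lam :=
    hlam.trans (Finset.sum_congr rfl fun i _ => (arms i).H_eq_optRate hl)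
  obtain ⟨C, hC⟩ := FeedbackMAB.exists_le_total_of_isThresholdWhittle arms hlam' hl x π hπ
  obtain ⟨C₁, hC₁⟩ := FeedbackMAB.exists_total_le arms hl x π
  obtain ⟨C₂, hC₂⟩ := FeedbackMAB.exists_total_le arms hl x σ
  obtain ⟨c₃, C₃, hC₃⟩ := FeedbackMAB.exists_le_total arms 0 x σ
  -- The `liminf` is at least `lam`, and the `limsup` is at most `lam + ∑ optRate = 2 * lam`.
  have h1 := FeedbackMAB.le_liminf_div hC hC₁
  have h2 := FeedbackMAB.limsup_div_le hC₃ hC₂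
  change Filter.limsup (fun T : ℕ => FeedbackMAB.total arms 0 x σ T / (T : ℝ)) Filter.atTop ≤
    2 * Filter.liminf (fun T : ℕ => FeedbackMAB.total arms 0 x π T / (T : ℝ)) Filter.atTop
  linarith
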